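/- **Setting.** Let $K\ge 2$ and $T\ge 2K$ be integers, let $G=([K],E)$ be a directed graph (self-loops allowed), and write $N^{\rm in}(i)=\{j:(j,i)\in E\}$. Assume that $G$ is strongly observable: every $i$ satisfies $i\in N^{\rm in}(i)$ or $N^{\rm in}(i)=[K]\setminus\{i\}$, and $N^{\rm in}(i)\neq\emptyset$. An adversary fixes loss vectors $\ell_1,\dots,\ell_T\in[0,1]^K$ in advance. In round $t$ the learner pulls an arm $i_t$, suffers $\ell_{t,i_t}$, and observes $\ell_{t,i}$ for all $i$ with $i_t\in N^{\rm in}(i)$. Put $L_i=\sum_{t=1}^T\ell_{t,i}$, let $i^\star$ be an arm minimizing $L_i$, $L_\star=L_{i^\star}$, and $\mathrm{Reg}=\mathbb E\big[\sum_{t=1}^T\ell_{t,i_t}\big]-L_\star$, the expectation being over the learner's randomness. Let $S=\{i: i\in N^{\rm in}(i)\}$, $\bar S=[K]\setminus S$, and let $\mathcal C_1,\dots,\mathcal C_\kappa$ be any partition of $S$ into $\kappa$ nonempty cliques (sets in which $(i,i')\in E$ for all distinct $i,i'$). The meta-nodes are the $\kappa$ cliques and the nodes of $\bar S$; let $\beta=\kappa+|\bar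 S|$ be their number. $D_\psi(x,y)=\psi(x)-\psi(y)-\langle\nabla\psi(y),x-y\rangle$ is the Bregman divergence, and $\Delta$ denotes the probability simplex. **Hedge instance on $C\subseteq[K]$.** It starts with $\widetilde p_1$ uniform on $C$. After it is fed its $t$-th loss vector $\widetilde\ell_t$, it sets $\widetilde p_{t+1}=\arg\min_p\{\langle p,\widetilde\ell_t\rangle+D_{\phi_t}(p,\widetilde p_t)\}$ over $\{p\in\Delta([K]):p_i\ge\frac1{|C|T}\ (i\in C),\ p_i=0\ (i\notin C)\}$, where $\phi_t(p)=\frac1{\eta_t}\sum_i p_i\ln p_i$, $\eta_t=\big(1+\sum_{\tau\le t}\sum_i\widetilde p_{\tau,i}\widetilde\ell_{\tau,i}^2\big)^{-1/2}$ (the divergence is taken on the coordinates in $C$). **The algorithm**, with parameters $c$ and $\eta$. Let $\Omega=\{p\in\Delta(\text{meta-nodes}):p_j\ge\frac1T\ \forall j\}$ and $$\psi_t(p)=\sum_{j\in[\kappa]}\frac1{\eta_{t,j}}\ln\frac1{p_j}+\frac1\eta\sum_{j\in\bar S}p_j\ln p_j+c\sum_{j\in\bar S}\ln\frac1{p_j}.$$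 *(Re)start* before round $t$: set $\eta_{t,j}=\eta$ and $\rho_{t,j}=2\kappa$ for $j\in[\kappa]$, set $p_t=\arg\min_{p\in\Omega}\psi_t(p)$, and create a new Hedge instance $\mathcal A_j$ on each $\mathcal C_j$. The algorithm starts before round $1$, and in each round $t=1,\dots,T$: 1. $\mathcal A_j$ proposes $\widetilde p^{(j)}_t$. Draw a meta-node $j_t\sim p_t$. If $j_t\in[\kappa]$, draw $i_t\sim\widetilde p_t^{(j_t)}$; otherwise $i_t=j_t$. Pull $i_t$. 2. Set $\widetilde\ell_{t,i}=\frac{\ell_{t,i}}{p_{t,j_t}}\mathbf 1\{j_t\in[\kappa],\,i\in\mathcal C_{j_t}\}$ for $i\in S$ and $\widetilde\ell_{t,i}=\frac{\ell_{t,i}}{1-p_{t,i}}\mathbf 1\{i\ne i_t\}$ for $i\in\bar S$; feed $\widetilde\ell_t$ to every $\mathcal A_j$. Set $\hat\ell_{t,j}=\langle\widetilde p_t^{(j)},\widetilde\ell_t\rangle$ for $j\in[\kappa]$ and $\hat\ell_{t,j}=\widetilde\ell_{t,j}$ for $j\in\bar S$. 3. Set $p_{t+1}=\arg\min_{p\in\Omega}\{\langle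 p,\hat\ell_t\rangle+D_{\psi_t}(p,p_t)\}$. For each $j\in[\kappa]$: if $1/p_{t+1,j}>\rho_{t,j}$, set $\rho_{t+1,j}=2/p_{t+1,j}$ and $\eta_{t+1,j}=\eta_{t,j}e^{1/\ln T}$; otherwise $\rho_{t+1,j}=\rho_{t,j}$ and $\eta_{t+1,j}=\eta_{t,j}$. 4. If $\frac{\kappa+1}{\eta}\le\eta\sum_{\tau}\langle p_\tau,\hat\ell_\tau\rangle$, the sum being over the rounds $\tau\le t$ since the last (re)start, replace $\eta$ by $\eta/2$ and restart before round $t+1$. **Theorem.** There are absolute constants $A$ and $m\in\mathbb N$ such that, for all $K$, $T$, $G$, $\ell_1,\dots,\ell_T$ and $\mathcal C_1,\dots,\mathcal C_\kappa$ as above, the algorithm with $c=64\beta$ and initial value $\eta=\frac1{2000(\ln T)\ln^2(KT)+80\kappa\ln T}$ (which does not depend on $L_\star$) satisfies $$\mathrm{Reg}\le A\,\ln^m(KT)\,\Big(\sqrt{(\kappa+1)L_\star}+\beta^2\Big).$$ In other words, $\mathrm{Reg}=\tilde{\mathcal O}\big(\sqrt{(\kappa+1)L_\star}+\beta^2\big)$.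 -/

import Mathlib

open Finset

noncomputable section

namespace GraphBandit

/-! ### Feedback graphs -/

/-- `N^in(i)`, the set of nodes that can observe `i`. -/
def inNbrs {K : ℕ} (G : Digraph (Fin K)) (i : Fin K) : Set (Fin K) := {j | G.Adj j i}

/-- Every node is observable, and moreover has a self-loop or is observed by all the other
nodes. -/
def StronglyObservable {K : ℕ} (G : Digraph (Fin K)) : Prop :=
  ∀ i, (inNbrs G i).Nonempty ∧ (i ∈ inNbrs G i ∨ inNbrs G i = {i}ᶜ)

/-- `C 0, …, C (κ - 1)` is a partition into nonempty cliques of the set `S` of nodes with a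
self-loop. -/
structure IsCliquePartition {K κ : ℕ} (G : Digraph (Fin K)) (C : Fin κ → Finset (Fin K)) :
    Prop where
  nonempty : ∀ j, (C j).Nonempty
  disjoint : ∀ j j', j ≠ j' → Disjoint (C j) (C j')
  covers : ∀ i, (∃ j, i ∈ C j) ↔ i ∈ inNbrs G i
  clique : ∀ j, ∀ i ∈ C j, ∀ i' ∈ C j, i ≠ i' → G.Adj i i'

/-- The set `S̄` of nodes without a self-loop, as a type. -/
abbrev NoLoop {K : ℕ} (G : Digraph (Fin K)) : Type := {i : Fin K // i ∉ inNbrs G i}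

instance {K : ℕ} (G : Digraph (Fin K)) : Fintype (NoLoop G) := Fintype.ofFinite _

/-- The meta-nodes: the `κ` cliques, and the nodes without a self-loop. -/
abbrev Meta {K : ℕ} (G : Digraph (Fin K)) (κ : ℕ) : Type := Fin κ ⊕ NoLoop G

/-- The number of meta-nodes, `β = κ + |S̄|`. -/
def metaCard {K : ℕ} (G : Digraph (Fin K)) (κ : ℕ) : ℕ := Fintype.card (Meta G κ)

/-! ### Mirror descent -/

/-- A minimizer of `f` over `s` (an arbitrary vector if there is none). -/
def argminOn {ι : Type*} (s : Set (ι → ℝ)) (f : (ι → ℝ) → ℝ) : ι → ℝ :=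
  Classical.epsilon fun x => x ∈ s ∧ IsMinOn f s x

/-- The Bregman divergence `ψ(x) - ψ(y) - ⟨∇ψ(y), x - y⟩`. The last term is written as the
derivative of `ψ` at `y` in the direction `x - y`, so that it also makes sense on a face of the
simplex, where coordinates that vanish in both `x` and `y` do not matter. -/
def bregman {ι : Type*} [Fintype ι] (ψ : (ι → ℝ) → ℝ) (x y : ι → ℝ) : ℝ :=
  ψ x - ψ y - lineDeriv ℝ ψ y (x - y)

/-- The mirror descent update `argmin_{p ∈ s} ⟨p, g⟩ + D_ψ(p, q)`. -/
def omdStep {ι : Type*} [Fintype ι] (s : Set (ι → ℝ)) (ψ : (ι → ℝ) → ℝ) (g q : ι → ℝ) :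
    ι → ℝ :=
  argminOn s fun p => p ⬝ᵥ g + bregman ψ p q

/-! ### Hedge with adaptive learning rates, on the set `C` of active arms -/

/-- The state of a Hedge instance: the distribution it proposes, and the sum
`∑_τ ∑_i p̃_{τ,i} ℓ̃_{τ,i}²` over the rounds `τ` it has been through. -/
structure HedgeState (K : ℕ) where
  prob : Fin K → ℝ
  sqSum : ℝ

open Classical in
/-- A new Hedge instance proposes the uniform distribution over `C`. -/
def hedgeInit {K : ℕ} (C : Finset (Fin K)) : HedgeState K where
  prob i := if i ∈ C then 1 / (C.card : ℝ) else 0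
  sqSum := 0

/-- The decision set of Hedge. -/
def hedgeDomain {K : ℕ} (T : ℕ) (C : Finset (Fin K)) : Set (Fin K → ℝ) :=
  {p | p ∈ stdSimplex ℝ (Fin K) ∧ (∀ i ∈ C, 1 / ((C.card : ℝ) * T) ≤ p i) ∧ ∀ i ∉ C, p i = 0}

/-- The entropy regularizer with learning rate `η`. -/
def entropyReg {K : ℕ} (η : ℝ) (p : Fin K → ℝ) : ℝ := 1 / η * ∑ i, p i * Real.log (p i)

/-- The state of a Hedge instance after it has been fed the loss vector `g`. -/
def hedgeStep {K : ℕ} (T : ℕ) (C : Finset (Fin K)) (h : HedgeState K) (g : Fin K → ℝ) :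
    HedgeState K :=
  let V := h.sqSum + ∑ i, h.prob i * g i ^ 2
  { prob := omdStep (hedgeDomain T C) (entropyReg √(1 / (1 + V))) g h.prob
    sqSum := V }

/-! ### The adaptive algorithm -/

/-- The state of the algorithm at the beginning of a round `t`. -/
structure State {K : ℕ} (G : Digraph (Fin K)) (κ : ℕ) where
  /-- the current value of `η` -/
  eta : ℝ
  /-- the learning rates `η_{t,j}` of the cliques -/
  rate : Fin κ → ℝ
  /-- the thresholds `ρ_{t,j}` -/
  rho : Fin κ → ℝ
  /-- the distribution `p_t` over the meta-nodes -/
  p : Meta G κ → ℝ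
  /-- the Hedge instances -/
  hedge : Fin κ → HedgeState K
  /-- the estimated cumulative loss `∑ ⟨p_τ, ℓ̂_τ⟩` over the past rounds `τ` since the last
  reset -/
  cumLoss : ℝ

/-- The hybrid regularizer: log-barrier with the rates `η_{t,j}` for the cliques, and entropy with
rate `η` plus `c` times the log-barrier for the nodes without a self-loop. -/
def hybridReg {K κ : ℕ} {G : Digraph (Fin K)} (c η : ℝ) (rate : Fin κ → ℝ) (p : Meta G κ → ℝ) :
    ℝ :=
  ∑ j : Fin κ, 1 / rate j * Real.log (1 / p (.inl j))
    + 1 / η * ∑ v : NoLoop G, p (.inr v) * Real.log (p (.inr v))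
    + c * ∑ v : NoLoop G, Real.log (1 / p (.inr v))

/-- The decision set `Ω` of the meta-algorithm. -/
def metaDomain {K : ℕ} (T : ℕ) (G : Digraph (Fin K)) (κ : ℕ) : Set (Meta G κ → ℝ) :=
  {p | p ∈ stdSimplex ℝ (Meta G κ) ∧ ∀ j, 1 / (T : ℝ) ≤ p j}

/-- The state after a (re)start with learning rate `η`. -/
def restart {K κ : ℕ} (T : ℕ) (G : Digraph (Fin K)) (C : Fin κ → Finset (Fin K)) (c η : ℝ) :
    State G κ where
  eta := η
  rate _ := η
  rho _ := 2 * κ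
  p := argminOn (metaDomain T G κ) (hybridReg c η fun _ => η)
  hedge j := hedgeInit (C j)
  cumLoss := 0

/-- The random choices of one round: the meta-node `j_t` and the arm `i_t`. -/
abbrev Choice {K : ℕ} (G : Digraph (Fin K)) (κ : ℕ) : Type := Meta G κ × Fin K

open Classical in
/-- The probability of drawing `(j_t, i_t)` in state `s`: the meta-node `j_t` is drawn from `p_t`;
if it is a clique, then `i_t` is drawn from the distribution of its Hedge instance, otherwise
`i_t = j_t`. -/
def choiceProb {K κ : ℕ} {G : Digraph (Fin K)} (s : State G κ) : Choice G κ → ℝ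
  | (.inl j, i) => s.p (.inl j) * (s.hedge j).prob i
  | (.inr v, i) => if i = v then s.p (.inr v) else 0

open Classical in
/-- The feedback when arm `a` is pulled: the losses of the arms that `a` observes (the unobserved
losses are replaced by zero). -/
def feedback {K : ℕ} (G : Digraph (Fin K)) (loss : Fin K → ℝ) (a : Fin K) (i : Fin K) : ℝ :=
  if a ∈ inNbrs G i then loss i else 0

open Classical in
/-- The estimator `ℓ̃_t`, computed from the feedback `fb` when the choices are `(j_t, i_t)`. -/
def armEstimator {K κ : ℕ} {G : Digraph (Fin K)} (C : Fin κ → Finset (Fin K)) (s : State G κ)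
    (x : Choice G κ) (fb : Fin K → ℝ) (i : Fin K) : ℝ :=
  if h : i ∈ inNbrs G i then
    match x.1 with
    | .inl j => if i ∈ C j then fb i / s.p (.inl j) else 0
    | .inr _ => 0
  else if i ≠ x.2 then fb i / (1 - s.p (.inr ⟨i, h⟩)) else 0

/-- The estimator `ℓ̂_t` for the meta-nodes, computed from `ℓ̃_t`. -/
def metaEstimator {K κ : ℕ} {G : Digraph (Fin K)} (s : State G κ) (est : Fin K → ℝ) :
    Meta G κ → ℝ
  | .inl j => (s.hedge j).prob ⬝ᵥ est
  | .inr v => est v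

open Classical in
/-- One round of the algorithm with horizon `T`: the state at the beginning of the next round, when
the choices are `x = (j_t, i_t)` and the loss vector is `loss`. -/
def step {K κ : ℕ} (T : ℕ) (G : Digraph (Fin K)) (C : Fin κ → Finset (Fin K)) (c : ℝ)
    (loss : Fin K → ℝ) (s : State G κ) (x : Choice G κ) : State G κ :=
  let est := armEstimator C s x (feedback G loss x.2)
  let mest := metaEstimator s est
  let p' := omdStep (metaDomain T G κ) (hybridReg c s.eta s.rate) mest s.p
  let cum := s.cumLoss + s.p ⬝ᵥ mest
  if ((κ : ℝ) + 1) / s.eta ≤ s.eta * cum then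
    restart T G C c (s.eta / 2)
  else
    { eta := s.eta
      rate := fun j =>
        if s.rho j < 1 / p' (.inl j) then s.rate j * Real.exp (1 / Real.log T) else s.rate j
      rho := fun j => if s.rho j < 1 / p' (.inl j) then 2 / p' (.inl j) else s.rho j
      p := p'
      hedge := fun j => hedgeStep T (C j) (s.hedge j) est
      cumLoss := cum }

/-! ### The law of the run and the regret

The loss vectors are `ℓ 0, …, ℓ (T - 1)`, and `ω : Fin n → Choice G κ` lists the random choices
of the first `n` rounds. -/

/-- The state after `n` rounds with choices `ω`, when the initial learning rate is `η`. -/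
def stateAfter {K κ : ℕ} (T : ℕ) (G : Digraph (Fin K)) (C : Fin κ → Finset (Fin K)) (c η : ℝ)
    (ℓ : ℕ → Fin K → ℝ) : (n : ℕ) → (Fin n → Choice G κ) → State G κ
  | 0, _ => restart T G C c η
  | n + 1, ω => step T G C c (ℓ n) (stateAfter T G C c η ℓ n (Fin.init ω)) (ω (Fin.last n))

/-- The probability that the choices of the first `n` rounds are `ω`. -/
def runProb {K κ : ℕ} (T : ℕ) (G : Digraph (Fin K)) (C : Fin κ → Finset (Fin K)) (c η : ℝ)
    (ℓ : ℕ → Fin K → ℝ) : (n : ℕ) → (Fin n → Choice G κ) → ℝ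
  | 0, _ => 1
  | n + 1, ω => runProb T G C c η ℓ n (Fin.init ω) *
      choiceProb (stateAfter T G C c η ℓ n (Fin.init ω)) (ω (Fin.last n))

/-- The total loss `L_i` of arm `i`. -/
def armLoss {K : ℕ} (T : ℕ) (ℓ : ℕ → Fin K → ℝ) (i : Fin K) : ℝ := ∑ t ∈ range T, ℓ t i

/-- The regret with respect to arm `i`: the expectation of `∑_t ℓ_{t,i_t} - ∑_t ℓ_{t,i}`. -/
def regret {K κ : ℕ} (T : ℕ) (G : Digraph (Fin K)) (C : Fin κ → Finset (Fin K)) (c η : ℝ)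
    (ℓ : ℕ → Fin K → ℝ) (i : Fin K) : ℝ :=
  ∑ ω : Fin T → Choice G κ,
    runProb T G C c η ℓ T ω * (∑ t : Fin T, ℓ t (ω t).2 - armLoss T ℓ i)

end GraphBandit

end

/-! The regret is bounded on every sample path for the estimated losses, and expectations are taken
only at the end.

Within one epoch `η` is fixed. A mirror descent step of the meta-algorithm has a stability cost of
at most `40 η ⟨p, ℓ̂⟩`, which is first order in the loss (`hybrid_omd_stability`). The dangerous
estimates belong to a node without a self-loop whose probability is close to 1. Subtracting this
estimate from all coordinates changes nothing on the simplex, and the log-barriers absorb the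
negative losses that this creates. Since the restart test has not yet fired, `η` times the
cumulative loss is below `(κ + 1) / η`, so these costs are of the order of `epochScale`.

This settles comparators without a self-loop. For an arm in clique `j`, the Hedge instance adds a
regret of order `√(ρ X)`, where `X` is its estimated loss and `ρ` essentially bounds `1 / p_j`.
Whenever `ρ` grows, the learning rate of `j` grows too, and the log-barrier divergence to the
comparator gives back a term proportional to `ρ / (η log T)` (`hybridDiv_advance_add_rateGain_le`).
By AM-GM this gain and a small multiple of `X` pay for Hedge (`CliqueInv.le`).

The round that triggers a restart can have a loss of order `1 / p_m` for the comparator `m`. The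
divergence that remains from `p` to the comparator is large enough to cover it (`MetaInv.le`).

Over all epochs the terms `(κ + 1) / η` form a geometric sum, and a restart certifies `(κ + 1) / η²
≤ 4 Z`, with `Z` the estimated loss so far. The total is therefore of order `√((κ + 1) Z)`
(`RunInv.regret_le`). Unbiasedness of the estimators and Jensen's inequality turn this into an
inequality for the regret `R` with `√((κ + 1) (R + L))` on the right (`regret_le_of_epochBound`),
which `le_of_le_add_mul_sqrt` solves for `R`. -/

namespace GraphBandit

/-! ### Scalar inequalities for the log-barrier and the entropy. -/

/-- The Bregman divergence of `-log`, between `x` and `1`. -/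
noncomputable def barrierGap (x : ℝ) : ℝ := x - 1 - Real.log x

/-- The Bregman divergence of `x ↦ x log x`, between `x` and `1`. -/
noncomputable def entropyGap (x : ℝ) : ℝ := x * Real.log x - x + 1

theorem barrierGap_nonneg {x : ℝ} (hx : 0 < x) : 0 ≤ barrierGap x := by
  have := Real.log_le_sub_one_of_pos hx
  unfold barrierGap; linarith

/-- Tangent line of `log` at 2. This linear growth is what later converts a barrier divergence into
a multiple of `1 / p`. -/
theorem half_sub_le_barrierGap {x : ℝ} (hx : 0 < x) : x / 2 - Real.log 2 ≤ barrierGap x := by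
  have h1 := Real.log_le_sub_one_of_pos (half_pos hx)
  rw [Real.log_div hx.ne' two_ne_zero] at h1
  unfold barrierGap; linarith

theorem sub_one_le_mul_barrierGap {c x : ℝ} (hc : 4 ≤ c) (hx : 2 ≤ x) :
    x - 1 ≤ c * barrierGap x := by
  have h0 := barrierGap_nonneg (show 0 < x by linarith)
  have h1 := half_sub_le_barrierGap (show 0 < x by linarith)
  have h2 := Real.log_two_lt_d9
  have h3 : 4 * barrierGap x ≤ c * barrierGap x := by gcongr
  linarith

/-- With `z = a * y`, the left side times `a` is maximal at `x = 1 / (1 + z)`, with value `z - log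
(1 + z)`. Bounding `log` at `(1 + z) * x` expresses this without calculus, and `z ≥ -1/2` keeps `(1
+ z)⁻¹ ≤ 2`. -/
theorem barrier_stability {a y x : ℝ} (ha : 0 < a) (hay : -(1 / 2) ≤ a * y) (hx : 0 < x) :
    y * (1 - x) - 1 / a * barrierGap x ≤ 2 * a * y ^ 2 := by
  set z := a * y with hz
  have hz1 : 0 < 1 + z := by linarith
  have h1 := Real.log_le_sub_one_of_pos (mul_pos hz1 hx)
  rw [Real.log_mul hz1.ne' hx.ne'] at h1
  have h2 := Real.one_sub_inv_le_log_of_pos hz1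
  have h3 : z - 2 * z ^ 2 ≤ 1 - (1 + z)⁻¹ := by
    have h4 : 1 - (1 + z)⁻¹ = z - z ^ 2 * (1 + z)⁻¹ := by field_simp; ring
    have h5 : (1 + z)⁻¹ ≤ 2 := by
      rw [inv_le_comm₀ hz1 two_pos]; linarith
    nlinarith [sq_nonneg z]
  have h6 : z * (1 - x) - barrierGap x ≤ 2 * z ^ 2 := by
    unfold barrierGap; nlinarith
  have h7 : y * (1 - x) - 1 / a * barrierGap x = 1 / a * (z * (1 - x) - barrierGap x) := by
    rw [hz]; field_simp
  have h8 : 2 * a * y ^ 2 = 1 / a * (2 * z ^ 2) := by rw [hz]; field_simp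
  rw [h7, h8]
  gcongr

theorem entropyGap_nonneg {x : ℝ} (hx : 0 < x) : 0 ≤ entropyGap x := by
  have := Real.one_sub_inv_le_log_of_pos hx
  have h2 : x * (1 - x⁻¹) = x - 1 := by field_simp
  have h3 := mul_le_mul_of_nonneg_left this hx.le
  unfold entropyGap; linarith

/-- For `x = r ^ 2`, the bound `log r ≥ 1 - 1 / r` gives `(r - 1) ^ 2 ≤ entropyGap x`, and `(r + 1)
^ 2 ≤ 6` as long as `r ≤ √2`. -/
theorem sq_div_six_le_entropyGap {x : ℝ} (hx : 0 < x) (hx2 : x ≤ 2) :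
    (x - 1) ^ 2 / 6 ≤ entropyGap x := by
  obtain ⟨r, hr, rfl⟩ : ∃ r : ℝ, 0 < r ∧ r ^ 2 = x :=
    ⟨√x, Real.sqrt_pos.2 hx, Real.sq_sqrt hx.le⟩
  have h1 := Real.one_sub_inv_le_log_of_pos hr
  have h2 : r ^ 2 * (1 - r⁻¹) = r ^ 2 - r := by field_simp
  have h3 := mul_le_mul_of_nonneg_left h1 (sq_nonneg r)
  have h4 : (r - 1) ^ 2 ≤ entropyGap (r ^ 2) := by
    unfold entropyGap
    rw [Real.log_pow]; push_cast; nlinarith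
  have h5 : (r + 1) ^ 2 ≤ 6 := by nlinarith [sq_nonneg (r - 3 / 2)]
  have h6 : (r ^ 2 - 1) ^ 2 = (r - 1) ^ 2 * (r + 1) ^ 2 := by ring
  have h7 : (r - 1) ^ 2 * (r + 1) ^ 2 ≤ (r - 1) ^ 2 * 6 := by gcongr
  linarith

/-- On `x ≤ 2` the entropy gap is at least quadratic, so completing the square works for losses of
either sign. -/
theorem entropy_stability_of_le {η p g x : ℝ} (hη : 0 < η) (hp : 0 < p) (hx : 0 < x)
    (hx2 : x ≤ 2) : p * g * (1 - x) - 1 / η * (p * entropyGap x) ≤ 2 * η * (p * g ^ 2) := by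
  have h1 := sq_div_six_le_entropyGap hx hx2
  have h2 : 1 / η * (p * ((x - 1) ^ 2 / 6)) ≤ 1 / η * (p * entropyGap x) := by gcongr
  have h3 : 2 * η * (p * g ^ 2) + 1 / η * (p * ((x - 1) ^ 2 / 6)) - p * g * (1 - x)
      = p / η * (2 * (η * g) ^ 2 + (x - 1) ^ 2 / 6 + (η * g) * (x - 1)) := by
    field_simp; ring
  have h4 : 0 ≤ p / η * (2 * (η * g) ^ 2 + (x - 1) ^ 2 / 6 + (η * g) * (x - 1)) := by
    apply mul_nonneg (by positivity)
    nlinarith [sq_nonneg ((x - 1) / 3 + (η * g) * (3 / 2)), sq_nonneg (η * g),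
      sq_nonneg (x - 1 + 3 * (η * g))]
  linarith

theorem entropy_stability_of_nonneg {η p g x : ℝ} (hη : 0 < η) (hp : 0 < p) (hg : 0 ≤ g)
    (hx : 0 < x) : p * g * (1 - x) - 1 / η * (p * entropyGap x) ≤ 2 * η * (p * g ^ 2) := by
  rcases le_total x 2 with h | h
  · exact entropy_stability_of_le hη hp hx h
  · have h1 : 0 ≤ 1 / η * (p * entropyGap x) := by
      have := entropyGap_nonneg hx; positivity
    have h2 : p * g * (1 - x) ≤ 0 := mul_nonpos_of_nonneg_of_nonpos (by positivity) (by linarith)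
    have h3 : 0 ≤ 2 * η * (p * g ^ 2) := by positivity
    linarith

/-- The entropy alone fails for negative `g` when `x` is large. There the gain is at most `x - 1`,
because `p * g ≥ -1`, and the log-barrier pays for it. -/
theorem hybrid_stability {η c p g x : ℝ} (hη : 0 < η) (hc : 4 ≤ c) (hp : 0 < p)
    (hg : -1 ≤ p * g) (hx : 0 < x) :
    p * g * (1 - x) - (1 / η * (p * entropyGap x) + c * barrierGap x) ≤ 2 * η * (p * g ^ 2) := by
  rcases le_total x 2 with h | h
  · have h1 := entropy_stability_of_le (g := g) hη hp hx h
    have h2 : 0 ≤ c * barrierGap x := mul_nonneg (by linarith) (barrierGap_nonneg hx)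
    linarith
  · have h1 : 0 ≤ 1 / η * (p * entropyGap x) := by
      have := entropyGap_nonneg hx; positivity
    have h2 := sub_one_le_mul_barrierGap hc h
    have h3 : 0 ≤ 2 * η * (p * g ^ 2) := by positivity
    nlinarith

/-! ### Mirror descent with a separable regularizer. -/

theorem argminOn_spec {ι : Type*} {s : Set (ι → ℝ)} {f : (ι → ℝ) → ℝ}
    (h : ∃ x ∈ s, IsMinOn f s x) : argminOn s f ∈ s ∧ IsMinOn f s (argminOn s f) :=
  Classical.epsilon_spec (p := fun x => x ∈ s ∧ IsMinOn f s x) h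

theorem IsMinOn.lineDeriv_nonneg {E : Type*} [AddCommGroup E] [Module ℝ E] {s : Set E}
    {f : E → ℝ} {x u : E} {c : ℝ} (hs : Convex ℝ s) (hx : x ∈ s) (hu : u ∈ s)
    (hmin : IsMinOn f s x) (hd : HasLineDerivAt ℝ f c x (u - x)) : 0 ≤ c := by
  have h1 := (hasDerivAt_iff_tendsto_slope_zero.1 hd).mono_left
    (nhdsWithin_mono (0 : ℝ) (fun t (ht : t ∈ Set.Ioi (0 : ℝ)) => ne_of_gt ht))
  refine ge_of_tendsto h1 ?_
  filter_upwards [Ioo_mem_nhdsGT (zero_lt_one' ℝ)] with t ht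
  have h2 : x + t • (u - x) ∈ s := hs.add_smul_sub_mem hx hu ⟨ht.1.le, ht.2.le⟩
  have h3 : f x ≤ f (x + t • (u - x)) := hmin h2
  simp only [zero_add, zero_smul, add_zero, smul_eq_mul]
  exact mul_nonneg (inv_nonneg.2 ht.1.le) (sub_nonneg.2 h3)

section Separable

variable {ι : Type*} [Fintype ι]

/-- The alternative `d i = 0` serves the arms outside a clique: they stay at 0, where `x log x` is
not differentiable. -/
theorem hasLineDerivAt_separable {f : ι → ℝ → ℝ} {f' : ι → ℝ} {y d : ι → ℝ}
    (h : ∀ i, HasDerivAt (f i) (f' i) (y i) ∨ d i = 0) :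
    HasLineDerivAt ℝ (fun p : ι → ℝ => ∑ i, f i (p i)) (∑ i, f' i * d i) y d := by
  unfold HasLineDerivAt
  refine HasDerivAt.fun_sum fun i _ => ?_
  simp only [Pi.add_apply, Pi.smul_apply, smul_eq_mul]
  rcases h i with h | h
  · have h1 : HasDerivAt (fun t : ℝ => y i + t * d i) (d i) 0 := by
      simpa using ((hasDerivAt_id (0 : ℝ)).mul_const (d i)).const_add (y i)
    have h2 : HasDerivAt (f i) (f' i) (y i + 0 * d i) := by simpa using h
    exact h2.comp 0 h1
  · simp only [h, mul_zero, add_zero]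
    exact hasDerivAt_const _ _

/-- The Bregman divergence of a separable function. -/
def separableDiv (f f' : ι → ℝ → ℝ) (x y : ι → ℝ) : ℝ :=
  ∑ i, (f i (x i) - f i (y i) - f' i (y i) * (x i - y i))

theorem bregman_separable {f f' : ι → ℝ → ℝ} {x y : ι → ℝ}
    (h : ∀ i, HasDerivAt (f i) (f' i (y i)) (y i) ∨ x i = y i) :
    bregman (fun p : ι → ℝ => ∑ i, f i (p i)) x y = separableDiv f f' x y := by
  have h1 : HasLineDerivAt ℝ (fun p : ι → ℝ => ∑ i, f i (p i))
      (∑ i, f' i (y i) * (x - y) i) y (x - y) :=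
    hasLineDerivAt_separable fun i => (h i).imp_right fun h => by simp [h]
  unfold bregman separableDiv
  rw [h1.lineDeriv]
  simp [sum_sub_distrib]

theorem argminOn_separable {s : Set (ι → ℝ)} {F : (ι → ℝ) → ℝ} {f f' : ι → ℝ → ℝ}
    (hs : Convex ℝ s) (hc : IsCompact s) (hne : s.Nonempty)
    (hf : ∀ p ∈ s, ∀ i, HasDerivAt (f i) (f' i (p i)) (p i) ∨ ∀ q ∈ s, q i = p i)
    (hF : ∀ p ∈ s, F p = ∑ i, f i (p i)) :
    argminOn s F ∈ s ∧
      ∀ u ∈ s, 0 ≤ ∑ i, f' i (argminOn s F i) * (u i - argminOn s F i) := by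
  have hcont : ContinuousOn F s := by
    refine ContinuousOn.congr (f := fun p : ι → ℝ => ∑ i, f i (p i)) ?_ hF
    refine continuousOn_finsetSum _ fun i _ p hp => ?_
    rcases hf p hp i with h | h
    · exact (ContinuousAt.comp (f := fun q : ι → ℝ => q i) h.continuousAt
        (continuous_apply i).continuousAt).continuousWithinAt
    · exact (continuousWithinAt_const (b := f i (p i))).congr
        (fun q hq => by rw [h q hq]) rfl
  obtain ⟨hm, hmin⟩ := argminOn_spec (hc.exists_isMinOn hne hcont)
  refine ⟨hm, fun u hu => ?_⟩
  have hmin' : IsMinOn (fun p : ι → ℝ => ∑ i, f i (p i)) s (argminOn s F) := fun q hq => by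
    have := hmin hq
    simp only [Set.mem_ofPred_eq] at this ⊢
    rwa [← hF _ hm, ← hF _ hq]
  refine IsMinOn.lineDeriv_nonneg hs hm hu hmin' ?_
  exact hasLineDerivAt_separable fun i => (hf _ hm i).imp_right fun h => by simp [h u hu]

/-- First-order optimality of the new point in the direction of `u`, rewritten with the three-point
identity for Bregman divergences. -/
theorem omdStep_separable {s : Set (ι → ℝ)} {f f' : ι → ℝ → ℝ} {ψ : (ι → ℝ) → ℝ}
    (hs : Convex ℝ s) (hc : IsCompact s)
    (hf : ∀ p ∈ s, ∀ i, HasDerivAt (f i) (f' i (p i)) (p i) ∨ ∀ q ∈ s, q i = p i)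
    (hψ : ψ = fun p => ∑ i, f i (p i)) (g : ι → ℝ) {q : ι → ℝ} (hq : q ∈ s) :
    omdStep s ψ g q ∈ s ∧ ∀ u ∈ s, omdStep s ψ g q ⬝ᵥ g - u ⬝ᵥ g ≤
      separableDiv f f' u q - separableDiv f f' u (omdStep s ψ g q)
        - separableDiv f f' (omdStep s ψ g q) q := by
  have key := argminOn_separable (F := fun p => p ⬝ᵥ g + bregman ψ p q)
    (f := fun i t => t * g i + (f i t - f i (q i) - f' i (q i) * (t - q i)))
    (f' := fun i t => g i + (f' i t - f' i (q i))) hs hc ⟨q, hq⟩ ?_ ?_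
  · refine ⟨key.1, fun u hu => ?_⟩
    have h1 := key.2 u hu
    change 0 ≤ ∑ i, (g i + (f' i (omdStep s ψ g q i) - f' i (q i))) *
      (u i - omdStep s ψ g q i) at h1
    refine le_of_sub_nonneg (h1.trans_eq ?_)
    unfold separableDiv dotProduct
    simp only [← sum_sub_distrib]
    exact sum_congr rfl fun i _ => by ring
  · intro p hp i
    refine (hf p hp i).imp_left fun h => ?_
    have h1 : HasDerivAt (fun t : ℝ => t * g i) (g i) (p i) := by
      simpa using (hasDerivAt_id (p i)).mul_const (g i)
    have h2 : HasDerivAt (fun t : ℝ => f' i (q i) * (t - q i)) (f' i (q i)) (p i) := by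
      simpa using ((hasDerivAt_id (p i)).sub_const (q i)).const_mul (f' i (q i))
    exact h1.add ((h.sub_const _).sub h2)
  · intro p hp
    rw [hψ, bregman_separable (f' := f') fun i => (hf q hq i).imp_right fun h => h p hp]
    unfold separableDiv dotProduct
    rw [← sum_add_distrib]

end Separable

/-! ### The decision sets -/

section Domains

variable {K κ T : ℕ} {G : Digraph (Fin K)} {C : Finset (Fin K)}

theorem convex_metaDomain : Convex ℝ (metaDomain T G κ) := by
  intro x hx y hy a b ha hb hab
  exact ⟨convex_stdSimplex ℝ _ hx.1 hy.1 ha hb hab, fun i =>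
    (convex_Ici (1 / (T : ℝ))) (hx.2 i) (hy.2 i) ha hb hab⟩

theorem isCompact_metaDomain : IsCompact (metaDomain T G κ) := by
  refine (isCompact_stdSimplex ℝ _).inter_right ?_
  change IsClosed {p : Meta G κ → ℝ | ∀ j, 1 / (T : ℝ) ≤ p j}
  simp only [Set.ofPred_forall]
  exact isClosed_iInter fun j => isClosed_le continuous_const (continuous_apply j)

theorem convex_hedgeDomain : Convex ℝ (hedgeDomain T C) := by
  intro x hx y hy a b ha hb hab
  refine ⟨convex_stdSimplex ℝ _ hx.1 hy.1 ha hb hab, fun i hi => ?_, fun i hi => ?_⟩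
  · exact (convex_Ici (1 / ((C.card : ℝ) * T))) (hx.2.1 i hi) (hy.2.1 i hi) ha hb hab
  · simp [hx.2.2 i hi, hy.2.2 i hi]

theorem isCompact_hedgeDomain : IsCompact (hedgeDomain T C) := by
  refine (isCompact_stdSimplex ℝ _).inter_right (IsClosed.inter ?_ ?_)
  · change IsClosed {p : Fin K → ℝ | ∀ i ∈ C, 1 / ((C.card : ℝ) * T) ≤ p i}
    simp only [Set.ofPred_forall]
    exact isClosed_iInter fun j => isClosed_iInter fun _ =>
      isClosed_le continuous_const (continuous_apply j)
  · change IsClosed {p : Fin K → ℝ | ∀ i ∉ C, p i = 0}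
    simp only [Set.ofPred_forall]
    exact isClosed_iInter fun j => isClosed_iInter fun _ =>
      isClosed_eq (continuous_apply j) continuous_const

end Domains

/-! ### Regret of Hedge with adaptive learning rates. -/

section Hedge

variable {K T : ℕ} {C : Finset (Fin K)}

/-- The relative entropy of `u` and `p`, as the Bregman divergence of the negative entropy. -/
noncomputable def entropyDiv (u p : Fin K → ℝ) : ℝ :=
  ∑ i, (u i * Real.log (u i) - p i * Real.log (p i) - (Real.log (p i) + 1) * (u i - p i))

theorem entropyDiv_term {u p : ℝ} (hp : 0 < p) (hu : 0 < u) :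
    u * Real.log u - p * Real.log p - (Real.log p + 1) * (u - p) = p * entropyGap (u / p) := by
  unfold entropyGap
  rw [Real.log_div hu.ne' hp.ne']
  field_simp
  ring

theorem hedgeDomain_pos (hT : 0 < T) {p : Fin K → ℝ} (hp : p ∈ hedgeDomain T C) {i : Fin K}
    (hi : i ∈ C) : 0 < p i := by
  refine lt_of_lt_of_le ?_ (hp.2.1 i hi)
  have : 0 < C.card := card_pos.2 ⟨i, hi⟩
  positivity

theorem entropyDiv_nonneg (hT : 0 < T) {u p : Fin K → ℝ} (hu : u ∈ hedgeDomain T C)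
    (hp : p ∈ hedgeDomain T C) : 0 ≤ entropyDiv u p := by
  refine sum_nonneg fun i _ => ?_
  by_cases hi : i ∈ C
  · have hp' := hedgeDomain_pos hT hp hi
    have hu' := hedgeDomain_pos hT hu hi
    rw [entropyDiv_term hp' hu']
    exact mul_nonneg hp'.le (entropyGap_nonneg (div_pos hu' hp'))
  · simp [hp.2.2 i hi, hu.2.2 i hi]

/-- The floor `1 / (|C| T)` on `p` is what makes the relative entropy bounded on all of the domain.
A bound at the initial point would not suffice, as the learning rate changes in every round. -/
theorem entropyDiv_le (hT : 0 < T) {u p : Fin K → ℝ} (hu : u ∈ hedgeDomain T C)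
    (hp : p ∈ hedgeDomain T C) : entropyDiv u p ≤ Real.log (K * T) := by
  have h1 : entropyDiv u p = ∑ i, u i * (Real.log (u i) - Real.log (p i)) := by
    have : entropyDiv u p = ∑ i, (u i * (Real.log (u i) - Real.log (p i)) - u i + p i) :=
      sum_congr rfl fun i _ => by ring
    rw [this, sum_add_distrib, sum_sub_distrib, hu.1.2, hp.1.2]; ring
  rw [h1]
  calc ∑ i, u i * (Real.log (u i) - Real.log (p i)) ≤ ∑ i, u i * Real.log (K * T) := by
        refine sum_le_sum fun i _ => ?_
        by_cases hi : i ∈ C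
        · refine mul_le_mul_of_nonneg_left ?_ (hu.1.1 i)
          have hu1 : u i ≤ 1 := by
            rw [← hu.1.2]; exact single_le_sum (fun j _ => hu.1.1 j) (mem_univ i)
          have h2 := Real.log_nonpos (hu.1.1 i) hu1
          have hc : 0 < C.card := card_pos.2 ⟨i, hi⟩
          have hcK : (C.card : ℝ) ≤ K := by
            have := card_le_univ C
            rw [Fintype.card_fin] at this
            exact_mod_cast this
          have hcT : (0 : ℝ) < C.card * T := by positivity
          have h3 := Real.log_le_log (by positivity) (hp.2.1 i hi)
          rw [one_div, Real.log_inv] at h3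
          have h4 : Real.log (C.card * T) ≤ Real.log (K * T) :=
            Real.log_le_log hcT (by gcongr)
          linarith
        · simp [hu.2.2 i hi]
    _ = Real.log (K * T) := by rw [← sum_mul, hu.1.2, one_mul]

theorem hedge_omdStep {η : ℝ} (hT : 0 < T) (hη : 0 < η) {p g : Fin K → ℝ}
    (hp : p ∈ hedgeDomain T C) (hg : ∀ i, 0 ≤ g i) :
    omdStep (hedgeDomain T C) (entropyReg η) g p ∈ hedgeDomain T C ∧
      ∀ u ∈ hedgeDomain T C, p ⬝ᵥ g - u ⬝ᵥ g ≤
        1 / η * (entropyDiv u p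
          - entropyDiv u (omdStep (hedgeDomain T C) (entropyReg η) g p))
        + 2 * η * ∑ i, p i * g i ^ 2 := by
  have key := omdStep_separable (ψ := entropyReg η) (f := fun _ t => 1 / η * (t * Real.log t))
    (f' := fun _ t => 1 / η * (Real.log t + 1)) convex_hedgeDomain isCompact_hedgeDomain
    (fun p hp i => ?_) (by funext p; simp only [entropyReg, mul_sum]) g hp
  · have hdiv : ∀ x y : Fin K → ℝ, separableDiv (fun _ t => 1 / η * (t * Real.log t))
        (fun _ t => 1 / η * (Real.log t + 1)) x y = 1 / η * entropyDiv x y := by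
      intro x y
      unfold separableDiv entropyDiv
      rw [mul_sum]
      exact sum_congr rfl fun i _ => by ring
    refine ⟨key.1, fun u hu => ?_⟩
    have h1 := key.2 u hu
    rw [hdiv, hdiv, hdiv] at h1
    set p' := omdStep (hedgeDomain T C) (entropyReg η) g p with hp'
    have h2 : p ⬝ᵥ g - p' ⬝ᵥ g - 1 / η * entropyDiv p' p ≤ 2 * η * ∑ i, p i * g i ^ 2 := by
      unfold dotProduct entropyDiv
      rw [mul_sum, mul_sum, ← sum_sub_distrib, ← sum_sub_distrib]
      refine sum_le_sum fun i _ => ?_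
      by_cases hi : i ∈ C
      · have hpi := hedgeDomain_pos hT hp hi
        have hpi' := hedgeDomain_pos hT key.1 hi
        rw [entropyDiv_term hpi hpi']
        have h3 := entropy_stability_of_nonneg hη hpi (hg i) (div_pos hpi' hpi)
        have h4 : p i * g i * (1 - p' i / p i) = p i * g i - p' i * g i := by
          field_simp
        linarith
      · simp [hp.2.2 i hi, key.1.2.2 i hi]
    linarith
  · by_cases hi : i ∈ C
    · have hpi := hedgeDomain_pos hT hp hi
      exact .inl ((Real.hasDerivAt_mul_log hpi.ne').const_mul _)
    · exact .inr fun q hq => by rw [hq.2.2 i hi, hp.2.2 i hi]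

theorem hedgeInit_mem (hT : 0 < T) (hC : C.Nonempty) : (hedgeInit C).prob ∈ hedgeDomain T C := by
  have hc : (0 : ℝ) < C.card := by exact_mod_cast card_pos.2 hC
  refine ⟨⟨fun i => ?_, ?_⟩, fun i hi => ?_, fun i hi => ?_⟩
  · simp only [hedgeInit]; split_ifs <;> positivity
  · simp [hedgeInit, hc.ne']
  · simp only [hedgeInit, hi, if_true]
    have : (1 : ℝ) ≤ T := by exact_mod_cast hT
    refine one_div_le_one_div_of_le hc ?_
    nlinarith
  · simp [hedgeInit, hi]

/-- The progress of a Hedge instance compared to `u`: here `X` is the loss it suffered, and `U` is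
the loss of `u`. -/
structure HedgeInv (T : ℕ) (C : Finset (Fin K)) (u : Fin K → ℝ) (h : HedgeState K) (X U : ℝ) :
    Prop where
  mem : h.prob ∈ hedgeDomain T C
  sqSum_nonneg : 0 ≤ h.sqSum
  le : X - U + √(1 + h.sqSum) * entropyDiv u h.prob
    ≤ (Real.log (K * T) + 4) * √(1 + h.sqSum)

theorem hedgeInv_init (hT : 0 < T) (hC : C.Nonempty) {u : Fin K → ℝ}
    (hu : u ∈ hedgeDomain T C) : HedgeInv T C u (hedgeInit C) 0 0 := by
  refine ⟨hedgeInit_mem hT hC, le_refl _, ?_⟩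
  have := entropyDiv_le hT hu (hedgeInit_mem hT hC)
  simp [hedgeInit] at this ⊢
  linarith

/-- Makes the stability terms `v / √(1 + V)` telescope. -/
theorem div_sqrt_le_sqrt_sub_sqrt {V v : ℝ} (hV : 0 ≤ V) (hv : 0 ≤ v) :
    v / √(1 + (V + v)) ≤ 2 * (√(1 + (V + v)) - √(1 + V)) := by
  have h1 : 0 < √(1 + (V + v)) := Real.sqrt_pos.2 (by linarith)
  have h2 := Real.sq_sqrt (show 0 ≤ 1 + (V + v) by linarith)
  have h3 := Real.sq_sqrt (show 0 ≤ 1 + V by linarith)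
  rw [div_le_iff₀ h1]
  nlinarith [sq_nonneg (√(1 + (V + v)) - √(1 + V))]

/-- Let `Δ` be the increase of `√(1 + V)`. Decreasing the learning rate costs at most `Δ log (K T)`,
and stability at most `4 Δ`, which explains the factor `log (K T) + 4` in the invariant. -/
theorem HedgeInv.step (hT : 0 < T) {u g : Fin K → ℝ} {h : HedgeState K} {X U : ℝ}
    (hu : u ∈ hedgeDomain T C) (hg : ∀ i, 0 ≤ g i) (hi : HedgeInv T C u h X U) :
    HedgeInv T C u (hedgeStep T C h g) (X + h.prob ⬝ᵥ g) (U + u ⬝ᵥ g) := by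
  set v := ∑ i, h.prob i * g i ^ 2 with hv
  have hv0 : 0 ≤ v := sum_nonneg fun i _ => mul_nonneg (hi.mem.1.1 i) (sq_nonneg _)
  have hV := hi.sqSum_nonneg
  have hV' : 0 < 1 + (h.sqSum + v) := by linarith
  have hS : 0 < √(1 + (h.sqSum + v)) := Real.sqrt_pos.2 hV'
  have hη : √(1 / (1 + (h.sqSum + v))) = 1 / √(1 + (h.sqSum + v)) := by
    rw [Real.sqrt_div zero_le_one, Real.sqrt_one]
  have key := hedge_omdStep hT (Real.sqrt_pos.2 (one_div_pos.2 hV')) hi.mem hg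
  have hle := key.2 u hu
  have hd := entropyDiv_le hT hu hi.mem
  refine ⟨key.1, by change 0 ≤ h.sqSum + v; linarith, ?_⟩
  change X + _ - (U + _) + √(1 + (h.sqSum + v)) * entropyDiv u (omdStep (hedgeDomain T C)
    (entropyReg √(1 / (1 + (h.sqSum + v)))) g h.prob) ≤ _ * √(1 + (h.sqSum + v))
  have h1 : 1 / √(1 / (1 + (h.sqSum + v))) = √(1 + (h.sqSum + v)) := by rw [hη, one_div_one_div]
  have h2 : 2 * √(1 / (1 + (h.sqSum + v))) * v = 2 * (v / √(1 + (h.sqSum + v))) := by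
    rw [hη]; ring
  rw [h1, ← hv, h2] at hle
  have h3 := div_sqrt_le_sqrt_sub_sqrt hV hv0
  have h4 : √(1 + h.sqSum) ≤ √(1 + (h.sqSum + v)) := Real.sqrt_le_sqrt (by linarith)
  have h5 : (√(1 + (h.sqSum + v)) - √(1 + h.sqSum)) * entropyDiv u h.prob ≤
      (√(1 + (h.sqSum + v)) - √(1 + h.sqSum)) * Real.log (K * T) :=
    mul_le_mul_of_nonneg_left hd (by linarith)
  have h6 := hi.le
  linarith

end Hedge

/-! ### Mirror descent with the hybrid regularizer. -/

section Meta

variable {K κ T : ℕ} {G : Digraph (Fin K)}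

/-- The Bregman divergence of the hybrid regularizer. -/
noncomputable def hybridDiv (c η : ℝ) (rate : Fin κ → ℝ) (u p : Meta G κ → ℝ) : ℝ :=
  ∑ j : Fin κ, 1 / rate j * barrierGap (u (.inl j) / p (.inl j))
    + ∑ v : NoLoop G, (1 / η * (p (.inr v) * entropyGap (u (.inr v) / p (.inr v)))
      + c * barrierGap (u (.inr v) / p (.inr v)))

/-- The coordinate functions of the hybrid regularizer. -/
noncomputable def hybridFun (c η : ℝ) (rate : Fin κ → ℝ) : Meta G κ → ℝ → ℝ
  | .inl j, t => 1 / rate j * -Real.log t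
  | .inr _, t => 1 / η * (t * Real.log t) + c * -Real.log t

/-- The derivatives of the coordinate functions of the hybrid regularizer. -/
noncomputable def hybridFun' (c η : ℝ) (rate : Fin κ → ℝ) : Meta G κ → ℝ → ℝ
  | .inl j, t => 1 / rate j * -t⁻¹
  | .inr _, t => 1 / η * (Real.log t + 1) + c * -t⁻¹

theorem hasDerivAt_hybridFun (c η : ℝ) (rate : Fin κ → ℝ) (m : Meta G κ) {t : ℝ} (ht : 0 < t) :
    HasDerivAt (hybridFun c η rate m) (hybridFun' c η rate m t) t := by
  rcases m with j | v
  · exact (Real.hasDerivAt_log ht.ne').neg.const_mul _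
  · exact ((Real.hasDerivAt_mul_log ht.ne').const_mul _).add
      ((Real.hasDerivAt_log ht.ne').neg.const_mul _)

theorem hybridReg_eq (c η : ℝ) (rate : Fin κ → ℝ) :
    hybridReg (G := G) c η rate = fun p => ∑ m, hybridFun c η rate m (p m) := by
  funext p
  simp [hybridReg, hybridFun, Fintype.sum_sum_type, sum_add_distrib, mul_sum, add_assoc]

theorem hybridFun_div (c η : ℝ) (rate : Fin κ → ℝ) {u p : Meta G κ → ℝ} (hu : ∀ m, 0 < u m)
    (hp : ∀ m, 0 < p m) : separableDiv (hybridFun c η rate) (hybridFun' c η rate) u p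
      = hybridDiv c η rate u p := by
  unfold separableDiv hybridDiv
  rw [Fintype.sum_sum_type]
  congr 1
  · refine sum_congr rfl fun j _ => ?_
    have h1 := hu (.inl j)
    have h2 := hp (.inl j)
    simp only [hybridFun, hybridFun', barrierGap]
    rw [Real.log_div h1.ne' h2.ne']
    field_simp
    ring
  · refine sum_congr rfl fun v _ => ?_
    have h1 := hu (.inr v)
    have h2 := hp (.inr v)
    simp only [hybridFun, hybridFun', barrierGap, entropyGap]
    rw [Real.log_div h1.ne' h2.ne']
    field_simp
    ring

theorem metaDomain_pos (hT : 0 < T) {p : Meta G κ → ℝ} (hp : p ∈ metaDomain T G κ)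
    (m : Meta G κ) : 0 < p m := by
  refine lt_of_lt_of_le ?_ (hp.2 m)
  positivity

/-- A loss vector for the meta-nodes that is small compared to the distribution `p`. -/
structure LossBound (p g : Meta G κ → ℝ) : Prop where
  nonneg : ∀ m, 0 ≤ g m
  clique : ∀ j, p (.inl j) * g (.inl j) ≤ 1
  noLoop : ∀ v, (1 - p (.inr v)) * g (.inr v) ≤ 1

/-- Here `s` is a common shift of the losses. As `p * g` and `p * s` lie in `[0, 1]`, the square of
their difference is at most their sum, so the second-order term becomes first order. -/
theorem clique_stability {η rate p g s x : ℝ} (hη : 10 * η ≤ 1) (hr : 0 < rate)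
    (hr5 : rate ≤ 5 * η) (hp : 0 < p) (hg : 0 ≤ g) (hpg : p * g ≤ 1) (hs : 0 ≤ s)
    (hps : p * s ≤ 1) (hx : 0 < x) :
    (g - s) * (p - x) - 1 / rate * barrierGap (x / p) ≤ 10 * η * (p * g + p * s) := by
  have h0 : 0 ≤ p * g := by positivity
  have h0' : 0 ≤ p * s := by positivity
  have h1 : -(1 / 2) ≤ rate * (p * (g - s)) := by nlinarith
  have h2 := barrier_stability hr h1 (div_pos hx hp)
  have h3 : p * (g - s) * (1 - x / p) = (g - s) * (p - x) := by field_simp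
  have h4 : (p * (g - s)) ^ 2 ≤ p * g + p * s := by nlinarith
  have h5 : 2 * rate * (p * (g - s)) ^ 2 ≤ 10 * η * (p * g + p * s) := by
    have : 0 ≤ η := by linarith
    calc 2 * rate * (p * (g - s)) ^ 2 ≤ 2 * (5 * η) * (p * g + p * s) := by gcongr
      _ = _ := by ring
  linarith

theorem noLoop_stability {η c p g s x : ℝ} (hη : 0 < η) (hc : 4 ≤ c) (hp : 0 < p) (hg : 0 ≤ g)
    (hg2 : g ≤ 2) (hs : 0 ≤ s) (hps : p * s ≤ 1) (hx : 0 < x) :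
    (g - s) * (p - x) - (1 / η * (p * entropyGap (x / p)) + c * barrierGap (x / p))
      ≤ 10 * η * (p * g + p * s ^ 2) := by
  have h1 : -1 ≤ p * (g - s) := by nlinarith
  have h2 := hybrid_stability hη hc hp h1 (div_pos hx hp)
  have h3 : p * (g - s) * (1 - x / p) = (g - s) * (p - x) := by field_simp
  have h4 : 2 * η * (p * (g - s) ^ 2) ≤ 10 * η * (p * g + p * s ^ 2) := by
    have h5 : (g - s) ^ 2 ≤ 5 * (g + s ^ 2) := by nlinarith
    calc 2 * η * (p * (g - s) ^ 2) ≤ 2 * η * (p * (5 * (g + s ^ 2))) := by gcongr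
      _ = _ := by ring
  linarith

/-- If no node without a self-loop has probability above 1/2, all their estimates are at most 2.
Otherwise the losses are shifted by the estimate `s` of the heavy node `v₀`. Its own term vanishes,
and the others have total mass `1 - p v₀`, where `(1 - p v₀) * s ≤ 1`. Hence the mass times `s ^ 2`
is at most `s ≤ 2 * p v₀ * s`, again a multiple of the loss. -/
theorem hybrid_omd_stability {c η : ℝ} {rate : Fin κ → ℝ} {p p' g : Meta G κ → ℝ}
    (hη : 0 < η) (hη10 : 10 * η ≤ 1) (hc : 4 ≤ c) (hr : ∀ j, 0 < rate j)
    (hr5 : ∀ j, rate j ≤ 5 * η) (hp : ∀ m, 0 < p m) (hp1 : ∑ m, p m = 1)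
    (hp' : ∀ m, 0 < p' m) (hp1' : ∑ m, p' m = 1) (hg : LossBound p g) :
    p ⬝ᵥ g - p' ⬝ᵥ g - hybridDiv c η rate p' p ≤ 40 * η * (p ⬝ᵥ g) := by
  classical
  set d : Meta G κ → ℝ := fun m => match m with
    | .inl j => 1 / rate j * barrierGap (p' (.inl j) / p (.inl j))
    | .inr v => 1 / η * (p (.inr v) * entropyGap (p' (.inr v) / p (.inr v)))
      + c * barrierGap (p' (.inr v) / p (.inr v)) with hd
  have hdiv : hybridDiv c η rate p' p = ∑ m, d m := by
    rw [Fintype.sum_sum_type]; rfl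
  -- Both distributions have mass 1, so a constant shift of the losses cancels.
  have hshift : ∀ s, p ⬝ᵥ g - p' ⬝ᵥ g - hybridDiv c η rate p' p
      = ∑ m, ((g m - s) * (p m - p' m) - d m) := by
    intro s
    have h1 : ∑ m, s * (p m - p' m) = 0 := by
      rw [← mul_sum, sum_sub_distrib, hp1, hp1']; ring
    rw [hdiv, ← sub_zero (p ⬝ᵥ g - p' ⬝ᵥ g), ← h1]
    unfold dotProduct
    simp only [← sum_sub_distrib]
    exact sum_congr rfl fun m _ => by ring
  have hpg : ∀ m, 0 ≤ p m * g m := fun m => mul_nonneg (hp m).le (hg.nonneg m)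
  have hX : 0 ≤ p ⬝ᵥ g := sum_nonneg fun m _ => hpg m
  have hsmall : ∀ v, p (.inr v) ≤ 1 / 2 → g (.inr v) ≤ 2 := fun v hv => by
    have h1 := hg.noLoop v
    have h2 := hg.nonneg (.inr v)
    nlinarith
  by_cases hbig : ∃ v : NoLoop G, 1 / 2 < p (.inr v)
  · obtain ⟨v₀, hv₀⟩ := hbig
    set s := g (.inr v₀) with hs
    have hs0 : 0 ≤ s := hg.nonneg _
    have hs1 : (1 - p (.inr v₀)) * s ≤ 1 := hg.noLoop v₀
    have hrest : ∑ m ∈ univ.erase (Sum.inr v₀ : Meta G κ), p m = 1 - p (.inr v₀) := by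
      rw [← hp1, ← add_sum_erase univ p (mem_univ (Sum.inr v₀ : Meta G κ))]; ring
    have hle : ∀ m ∈ univ.erase (Sum.inr v₀ : Meta G κ), p m ≤ 1 - p (.inr v₀) :=
      fun m hm => by
        rw [← hrest]; exact single_le_sum (fun i _ => (hp i).le) hm
    have hps : ∀ m ∈ univ.erase (Sum.inr v₀ : Meta G κ), p m * s ≤ 1 := fun m hm =>
      (mul_le_mul_of_nonneg_right (hle m hm) hs0).trans hs1
    have hterm : ∀ m ∈ univ.erase (Sum.inr v₀ : Meta G κ),
        (g m - s) * (p m - p' m) - d m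
          ≤ 10 * η * (p m * g m + p m * s + p m * s ^ 2) := fun m hm => by
      have e1 : 0 ≤ 10 * η * (p m * s) := by have := hp m; positivity
      have e2 : 0 ≤ 10 * η * (p m * s ^ 2) := by have := hp m; positivity
      rcases m with j | v
      · have := clique_stability hη10 (hr j) (hr5 j) (hp (.inl j)) (hg.nonneg _) (hg.clique j)
          hs0 (hps _ hm) (hp' (.inl j))
        linarith
      · have hv : p (.inr v) ≤ 1 / 2 := by linarith [hle _ hm]
        have := noLoop_stability hη hc (hp (.inr v)) (hg.nonneg _) (hsmall v hv)
          hs0 (hps _ hm) (hp' (.inr v))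
        linarith
    have hd0 : 0 ≤ d (.inr v₀) := by
      have h1 := div_pos (hp' (.inr v₀)) (hp (.inr v₀))
      have h2 := entropyGap_nonneg h1
      have h3 := barrierGap_nonneg h1
      have h4 := hp (.inr v₀)
      simp only [hd]
      positivity
    rw [hshift s, ← add_sum_erase univ _ (mem_univ (Sum.inr v₀ : Meta G κ))]
    have h1 := sum_le_sum hterm
    rw [← mul_sum, sum_add_distrib, sum_add_distrib, ← sum_mul, ← sum_mul, hrest] at h1
    have h2 : ∑ m ∈ univ.erase (Sum.inr v₀ : Meta G κ), p m * g m + p (.inr v₀) * s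
        = p ⬝ᵥ g := by
      unfold dotProduct
      rw [← add_sum_erase univ (fun m => p m * g m) (mem_univ (Sum.inr v₀ : Meta G κ))]; ring
    have h3 : (1 - p (.inr v₀)) * s ≤ p (.inr v₀) * s := by gcongr; linarith
    have h4 : (1 - p (.inr v₀)) * s ^ 2 ≤ 2 * (p (.inr v₀) * s) := by nlinarith
    have h5 : p (.inr v₀) * s ≤ p ⬝ᵥ g := by
      rw [← h2]
      linarith [sum_nonneg fun (m : Meta G κ) (_ : m ∈ univ.erase (Sum.inr v₀)) => hpg m]
    have h6 : 10 * η * (∑ m ∈ univ.erase (Sum.inr v₀ : Meta G κ), p m * g m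
        + (1 - p (.inr v₀)) * s + (1 - p (.inr v₀)) * s ^ 2) ≤ 10 * η * (4 * (p ⬝ᵥ g)) := by
      gcongr; linarith
    have h7 : (g (.inr v₀) - s) * (p (.inr v₀) - p' (.inr v₀)) = 0 := by rw [hs]; ring
    linarith
  · push Not at hbig
    rw [hshift 0]
    have hterm : ∀ m, (g m - 0) * (p m - p' m) - d m ≤ 10 * η * (p m * g m) := fun m => by
      rcases m with j | v
      · have := clique_stability (s := 0) hη10 (hr j) (hr5 j) (hp (.inl j)) (hg.nonneg _)
          (hg.clique j) le_rfl (by simp) (hp' (.inl j))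
        linarith
      · have := noLoop_stability (s := 0) hη hc (hp (.inr v)) (hg.nonneg _)
          (hsmall v (hbig v)) le_rfl (by simp) (hp' (.inr v))
        have e : p (.inr v) * (0 : ℝ) ^ 2 = 0 := by norm_num
        rw [e, add_zero] at this
        linarith
    refine (sum_le_sum fun m _ => hterm m).trans ?_
    rw [← mul_sum]
    change 10 * η * (p ⬝ᵥ g) ≤ _
    have : 0 ≤ η * (p ⬝ᵥ g) := by positivity
    linarith

theorem hybrid_omdStep {c η : ℝ} {rate : Fin κ → ℝ} {p g : Meta G κ → ℝ} (hT : 0 < T)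
    (hη : 0 < η) (hη10 : 10 * η ≤ 1) (hc : 4 ≤ c) (hr : ∀ j, 0 < rate j)
    (hr5 : ∀ j, rate j ≤ 5 * η) (hp : p ∈ metaDomain T G κ) (hg : LossBound p g) :
    omdStep (metaDomain T G κ) (hybridReg c η rate) g p ∈ metaDomain T G κ ∧
      ∀ u ∈ metaDomain T G κ, p ⬝ᵥ g - u ⬝ᵥ g ≤ hybridDiv c η rate u p
        - hybridDiv c η rate u (omdStep (metaDomain T G κ) (hybridReg c η rate) g p)
        + 40 * η * (p ⬝ᵥ g) := by
  have key := omdStep_separable (f' := hybridFun' c η rate) convex_metaDomain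
    isCompact_metaDomain
    (fun q hq m => .inl (hasDerivAt_hybridFun c η rate m (metaDomain_pos hT hq m)))
    (hybridReg_eq c η rate) g hp
  refine ⟨key.1, fun u hu => ?_⟩
  have h1 := key.2 u hu
  have hp0 := metaDomain_pos hT hp
  have hp0' := metaDomain_pos hT key.1
  have hu0 := metaDomain_pos hT hu
  rw [hybridFun_div _ _ _ hu0 hp0, hybridFun_div _ _ _ hu0 hp0',
    hybridFun_div _ _ _ hp0' hp0] at h1
  have h2 := hybrid_omd_stability hη hη10 hc hr hr5 hp0 hp.1.2 hp0' key.1.1.2 hg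
  linarith

theorem le_one_of_mem_metaDomain {p : Meta G κ → ℝ} (hp : p ∈ metaDomain T G κ)
    (m : Meta G κ) : p m ≤ 1 := by
  rw [← hp.1.2]; exact single_le_sum (fun j _ => hp.1.1 j) (mem_univ m)

/-- The starting point of an epoch minimizes the regularizer, so that its divergence to any other
point is at most the range of the regularizer. -/
theorem restart_div_le {c η : ℝ} (hT : 0 < T) (hη : 0 < η) (hc : 0 ≤ c)
    (hne : (metaDomain T G κ).Nonempty) :
    argminOn (metaDomain T G κ) (hybridReg c η fun _ => η) ∈ metaDomain T G κ ∧
      ∀ u ∈ metaDomain T G κ, hybridDiv c η (fun _ => η) u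
        (argminOn (metaDomain T G κ) (hybridReg c η fun _ => η))
        ≤ ((κ + 1) / η + c * metaCard G κ) * Real.log T := by
  have key := argminOn_separable (F := hybridReg c η fun _ => η)
    (f' := hybridFun' c η fun _ => η) convex_metaDomain isCompact_metaDomain hne
    (fun q hq m => .inl (hasDerivAt_hybridFun c η _ m (metaDomain_pos hT hq m)))
    (fun p _ => by rw [hybridReg_eq])
  refine ⟨key.1, fun u hu => ?_⟩
  set p := argminOn (metaDomain T G κ) (hybridReg c η fun _ => η) with hp
  have hp0 := metaDomain_pos hT key.1
  have hu0 := metaDomain_pos hT hu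
  rw [← hybridFun_div _ _ _ hu0 hp0]
  have h1 := key.2 u hu
  -- By optimality of `p`, the linear term of the divergence has a favourable sign and can be
  -- dropped.
  have h2 : separableDiv (hybridFun c η fun _ => η) (hybridFun' c η fun _ => η) u p
      ≤ ∑ m, (hybridFun c η (fun _ => η) m (u m) - hybridFun c η (fun _ => η) m (p m)) := by
    unfold separableDiv
    rw [sum_sub_distrib]
    linarith
  refine h2.trans ?_
  have hT1 : (1 : ℝ) ≤ T := by exact_mod_cast hT
  have hlogT : 0 ≤ Real.log T := Real.log_nonneg hT1
  have hlow : ∀ q ∈ metaDomain T G κ, ∀ m, -Real.log (q m) ≤ Real.log T := fun q hq m => by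
    have := Real.log_le_log (by positivity) (hq.2 m)
    rw [one_div, Real.log_inv] at this
    linarith
  have hup : ∀ q ∈ metaDomain T G κ, ∀ m, Real.log (q m) ≤ 0 := fun q hq m =>
    Real.log_nonpos (hq.1.1 m) (le_one_of_mem_metaDomain hq m)
  have hc1 : ∀ m, c * -Real.log (u m) - c * -Real.log (p m) ≤ c * Real.log T := fun m => by
    rw [← mul_sub]
    refine mul_le_mul_of_nonneg_left ?_ hc
    linarith [hlow u hu m, hup p key.1 m]
  rw [Fintype.sum_sum_type]
  have hcl : ∀ j : Fin κ, hybridFun (G := G) c η (fun _ => η) (.inl j) (u (.inl j))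
      - hybridFun (G := G) c η (fun _ => η) (.inl j) (p (.inl j)) ≤ 1 / η * Real.log T := fun j => by
    simp only [hybridFun]
    rw [← mul_sub]
    refine mul_le_mul_of_nonneg_left ?_ (by positivity)
    linarith [hlow u hu (.inl j), hup p key.1 (.inl j)]
  -- The factor `p (.inr v)` is kept: summed over `v`, the entropy part gives one `log T / η` in
  -- total instead of one per node. Hence `κ + 1`, and not the number of meta-nodes, multiplies `1 /
  -- η`.
  have hnl : ∀ v : NoLoop G, hybridFun (κ := κ) c η (fun _ => η) (.inr v) (u (.inr v))
      - hybridFun (κ := κ) c η (fun _ => η) (.inr v) (p (.inr v))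
      ≤ 1 / η * Real.log T * p (.inr v) + c * Real.log T := fun v => by
    simp only [hybridFun]
    have h3 : 1 / η * (u (.inr v) * Real.log (u (.inr v))) ≤ 0 :=
      mul_nonpos_of_nonneg_of_nonpos (by positivity)
        (mul_nonpos_of_nonneg_of_nonpos (hu0 _).le (hup u hu _))
    have h4 : 1 / η * (p (.inr v) * -Real.log (p (.inr v)))
        ≤ 1 / η * (p (.inr v) * Real.log T) := by
      have := hlow p key.1 (.inr v)
      have := (hp0 (.inr v)).le
      gcongr
    linarith [hc1 (.inr v)]
  have h5 := sum_le_sum fun j (_ : j ∈ (univ : Finset (Fin κ))) => hcl j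
  have h6 := sum_le_sum fun v (_ : v ∈ (univ : Finset (NoLoop G))) => hnl v
  rw [sum_add_distrib, ← mul_sum] at h6
  simp only [sum_const, card_univ, Fintype.card_fin, nsmul_eq_mul] at h5 h6
  have h7 : ∑ v : NoLoop G, p (.inr v) ≤ 1 := by
    have := key.1.1.2
    rw [Fintype.sum_sum_type] at this
    linarith [sum_nonneg fun (j : Fin κ) (_ : j ∈ univ) => (hp0 (.inl j)).le]
  have h8 : 1 / η * Real.log T * ∑ v : NoLoop G, p (.inr v) ≤ 1 / η * Real.log T * 1 := by
    gcongr
  have h9 : (Fintype.card (NoLoop G) : ℝ) ≤ metaCard G κ := by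
    unfold metaCard
    rw [Fintype.card_sum]; push_cast; linarith [Nat.cast_nonneg (α := ℝ) (Fintype.card (Fin κ))]
  have h10 : (Fintype.card (NoLoop G) : ℝ) * (c * Real.log T)
      ≤ metaCard G κ * (c * Real.log T) := by gcongr
  have h11 : ((κ + 1) / η + c * metaCard G κ) * Real.log T
    = κ * (1 / η * Real.log T) + 1 / η * Real.log T * 1 + metaCard G κ * (c * Real.log T) := by
    ring
  linarith

theorem mul_barrierGap_le_hybridDiv {c η a : ℝ} {rate : Fin κ → ℝ} {u p : Meta G κ → ℝ}
    (hη : 0 < η) (hc : 0 ≤ c) (hr : ∀ j, 0 < rate j) (hu : ∀ m, 0 < u m) (hp : ∀ m, 0 < p m)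
    (m : Meta G κ) (ha : match m with | .inl j => a ≤ 1 / rate j | .inr _ => a ≤ c) :
    a * barrierGap (u m / p m) ≤ hybridDiv c η rate u p := by
  have hb : ∀ m, 0 ≤ barrierGap (u m / p m) := fun m => barrierGap_nonneg (div_pos (hu m) (hp m))
  have h1 : ∀ j, 0 ≤ 1 / rate j * barrierGap (u (.inl j) / p (.inl j)) := fun j =>
    mul_nonneg (one_div_pos.2 (hr j)).le (hb _)
  have h2 : ∀ v, c * barrierGap (u (.inr v) / p (.inr v))
      ≤ 1 / η * (p (.inr v) * entropyGap (u (.inr v) / p (.inr v)))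
        + c * barrierGap (u (.inr v) / p (.inr v)) := fun v => by
    have h3 := entropyGap_nonneg (div_pos (hu (.inr v)) (hp (.inr v)))
    have h4 := hp (.inr v)
    have : 0 ≤ 1 / η * (p (.inr v) * entropyGap (u (.inr v) / p (.inr v))) := by positivity
    linarith
  have h3 : ∀ v, 0 ≤ c * barrierGap (u (.inr v) / p (.inr v)) := fun v => mul_nonneg hc (hb _)
  unfold hybridDiv
  rcases m with j | v
  · have h4 := single_le_sum (fun j _ => h1 j) (mem_univ j)
    have h5 := sum_nonneg fun v (_ : v ∈ univ) => (h3 v).trans (h2 v)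
    have h6 := mul_le_mul_of_nonneg_right ha (hb (.inl j))
    linarith
  · have h4 := single_le_sum (fun v _ => (h3 v).trans (h2 v)) (mem_univ v)
    have h5 := sum_nonneg fun j (_ : j ∈ univ) => h1 j
    have h6 := mul_le_mul_of_nonneg_right ha (hb (.inr v))
    have h7 := h2 v
    linarith

end Meta

/-! ### The setting and the comparator of the meta-algorithm. -/

/-- The standing assumptions on the problem. -/
structure Setting {K κ : ℕ} (T : ℕ) (G : Digraph (Fin K)) (C : Fin κ → Finset (Fin K)) :
    Prop where
  two_le : 2 ≤ K
  two_mul_le : 2 * K ≤ T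
  observable : StronglyObservable G
  partition : IsCliquePartition G C

section

variable {K κ T : ℕ} {G : Digraph (Fin K)} {C : Fin κ → Finset (Fin K)}

theorem IsCliquePartition.eq_of_mem (hC : IsCliquePartition G C) {i : Fin K} {j j' : Fin κ}
    (hj : i ∈ C j) (hj' : i ∈ C j') : j = j' := by
  by_contra h
  exact Finset.disjoint_left.1 (hC.disjoint j j' h) hj hj'

theorem IsCliquePartition.mem_inNbrs (hC : IsCliquePartition G C) {i : Fin K} {j : Fin κ}
    (hj : i ∈ C j) : i ∈ inNbrs G i := (hC.covers i).1 ⟨j, hj⟩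

/-- A chosen arm in each clique represents it. These arms are distinct by disjointness, and differ
from the nodes of `S̄` because they have self-loops. -/
theorem IsCliquePartition.metaCard_le (hC : IsCliquePartition G C) : metaCard G κ ≤ K := by
  have hinj : Function.Injective (fun m : Meta G κ => match m with
      | .inl j => (hC.nonempty j).choose
      | .inr v => v.1) := by
    rintro (j | v) (j' | v') h
    · have h1 := (hC.nonempty j).choose_spec
      have h2 := (hC.nonempty j').choose_spec
      simp only at h
      rw [← h] at h2
      rw [hC.eq_of_mem h1 h2]
    · have h1 := hC.mem_inNbrs (hC.nonempty j).choose_spec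
      simp only at h
      rw [h] at h1
      exact absurd h1 v'.2
    · have h1 := hC.mem_inNbrs (hC.nonempty j').choose_spec
      simp only at h
      rw [← h] at h1
      exact absurd h1 v.2
    · simp only at h
      rw [Subtype.ext h]
  have := Fintype.card_le_of_injective _ hinj
  rwa [Fintype.card_fin] at this

theorem kappa_le_metaCard : κ ≤ metaCard G κ := by
  unfold metaCard; simp [Fintype.card_sum]

theorem one_le_log_of_four_le {x : ℝ} (hx : 4 ≤ x) : 1 ≤ Real.log x := by
  have h := Real.log_le_log (by norm_num) hx
  have h2 : Real.log 4 = 2 * Real.log 2 := by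
    rw [show (4 : ℝ) = 2 ^ 2 by norm_num, Real.log_pow]; norm_num
  have := Real.log_two_gt_d9
  linarith

namespace Setting

variable (hS : Setting T G C)
include hS

theorem four_le : 4 ≤ T := by have := hS.two_le; have := hS.two_mul_le; omega

theorem T_pos : 0 < T := by have := hS.four_le; omega

theorem four_le_cast : (4 : ℝ) ≤ T := by exact_mod_cast hS.four_le

theorem one_le_log : 1 ≤ Real.log T := one_le_log_of_four_le hS.four_le_cast

theorem two_le_cast : (2 : ℝ) ≤ K := by exact_mod_cast hS.two_le

theorem log_le_log : Real.log T ≤ Real.log (K * T) := by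
  have := hS.four_le_cast
  have := hS.two_le_cast
  exact Real.log_le_log (by linarith) (by nlinarith)

theorem two_le_log : 2 ≤ Real.log (K * T) := by
  have h4 := hS.four_le_cast
  have h2 := hS.two_le_cast
  have h := Real.log_le_log (by norm_num) (show (8 : ℝ) ≤ K * T by nlinarith)
  have h2 : Real.log 8 = 3 * Real.log 2 := by
    rw [show (8 : ℝ) = 2 ^ 3 by norm_num, Real.log_pow]; norm_num
  have := Real.log_two_gt_d9
  linarith

theorem two_mul_metaCard_le : 2 * (metaCard G κ : ℝ) ≤ T := by
  have := hS.partition.metaCard_le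
  have := hS.two_mul_le
  exact_mod_cast (by omega : 2 * metaCard G κ ≤ T)

theorem nonempty_meta : Nonempty (Meta G κ) := by
  have h0 : 0 < K := by have := hS.two_le; omega
  by_cases h : (⟨0, h0⟩ : Fin K) ∈ inNbrs G ⟨0, h0⟩
  · obtain ⟨j, -⟩ := (hS.partition.covers _).2 h
    exact ⟨.inl j⟩
  · exact ⟨.inr ⟨_, h⟩⟩

theorem one_le_metaCard : 1 ≤ (metaCard G κ : ℝ) := by
  obtain ⟨m⟩ := hS.nonempty_meta
  have : 0 < metaCard G κ := Fintype.card_pos_iff.2 ⟨m⟩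
  exact_mod_cast this

/-- Some other arm observes `v`. The second meta-node keeps `1 - p v` away from 0, so that the
estimator of `v` does not divide by 0. -/
theorem exists_ne_noLoop (v : NoLoop G) : ∃ m : Meta G κ, m ≠ .inr v := by
  obtain ⟨⟨i, hi⟩, h⟩ := hS.observable v.1
  have hiv : i ≠ v.1 := fun h => v.2 (h ▸ hi)
  by_cases h : i ∈ inNbrs G i
  · obtain ⟨j, -⟩ := (hS.partition.covers _).2 h
    exact ⟨.inl j, by simp⟩
  · exact ⟨.inr ⟨i, h⟩, fun h => hiv (by simpa using congrArg (Sum.elim (fun _ => i) Subtype.val) h)⟩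

end Setting

theorem metaDomain_add_le {p : Meta G κ → ℝ} (hp : p ∈ metaDomain T G κ) {m m' : Meta G κ}
    (h : m ≠ m') : p m + p m' ≤ 1 := by
  classical
  rw [← hp.1.2, ← sum_pair h]
  exact sum_le_sum_of_subset_of_nonneg (subset_univ _) fun i _ _ => hp.1.1 i

/-- The comparator of the meta-algorithm: the node `m`, mixed with the uniform distribution. -/
noncomputable def comparator (T : ℕ) (m : Meta G κ) : Meta G κ → ℝ := by
  classical exact fun m' => (if m' = m then 1 - (metaCard G κ : ℝ) / T else 0) + 1 / T

theorem comparator_mem (hS : Setting T G C) (m : Meta G κ) :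
    comparator T m ∈ metaDomain T G κ := by
  have hT := hS.four_le_cast
  have hT0 : (0 : ℝ) < T := by linarith
  have hβ := hS.two_mul_metaCard_le
  have h1 : (metaCard G κ : ℝ) / T ≤ 1 := by
    rw [div_le_one hT0]; linarith [hS.one_le_metaCard]
  have h2 : ∀ m', 1 / (T : ℝ) ≤ comparator T m m' := fun m' => by
    simp only [comparator]
    split_ifs <;> linarith
  refine ⟨⟨fun m' => le_trans (by positivity) (h2 m'), ?_⟩, h2⟩
  simp only [comparator, sum_add_distrib, sum_ite_eq', mem_univ, if_true, sum_const, card_univ,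
    nsmul_eq_mul]
  unfold metaCard
  field_simp
  ring

theorem half_le_comparator (hS : Setting T G C) (m : Meta G κ) : 1 / 2 ≤ comparator T m m := by
  have hT := hS.four_le_cast
  have hT0 : (0 : ℝ) < T := by linarith
  have h1 : (metaCard G κ : ℝ) / T ≤ 1 / 2 := by
    rw [div_le_iff₀ hT0]; linarith [hS.two_mul_metaCard_le]
  have h2 : 0 ≤ 1 / (T : ℝ) := by positivity
  simp only [comparator, if_true]
  linarith

theorem comparator_dotProduct_le (m : Meta G κ) {g : Meta G κ → ℝ} (hg : ∀ m, 0 ≤ g m) :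
    comparator T m ⬝ᵥ g ≤ g m + 1 / T * ∑ m', g m' := by
  classical
  have h1 : comparator T m ⬝ᵥ g
      = (1 - (metaCard G κ : ℝ) / T) * g m + 1 / T * ∑ m', g m' := by
    simp only [comparator, dotProduct, add_mul, sum_add_distrib, mul_sum, ite_mul, zero_mul,
      sum_ite_eq', mem_univ, if_true]
  rw [h1]
  have h2 : 0 ≤ (metaCard G κ : ℝ) / T := by positivity
  nlinarith [hg m]

/-! ### Invariants of the state -/

/-- What holds for the state at the beginning of any round. -/
structure Valid (T : ℕ) (C : Fin κ → Finset (Fin K)) (s : State G κ) : Prop where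
  eta_pos : 0 < s.eta
  eta_le : s.eta * (2000 * Real.log T * Real.log (K * T) ^ 2) ≤ 1
  p_mem : s.p ∈ metaDomain T G κ
  hedge_mem : ∀ j, (s.hedge j).prob ∈ hedgeDomain T (C j)
  sqSum_nonneg : ∀ j, 0 ≤ (s.hedge j).sqSum
  two_le_rho : ∀ j, 2 ≤ s.rho j
  rho_le : ∀ j, s.rho j ≤ 2 * T
  rate_pos : ∀ j, 0 < s.rate j
  rate_le : ∀ j, s.rate j
    ≤ s.eta * Real.exp (Real.log (s.rho j / 2) / (Real.log 2 * Real.log T))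
  cum_nonneg : 0 ≤ s.cumLoss
  cum_lt : s.eta * s.cumLoss < (κ + 1) / s.eta

theorem exp_le_five {x : ℝ} (hx : x ≤ 3 / 2) : Real.exp x ≤ 5 := by
  refine (Real.exp_le_exp.2 hx).trans ?_
  have h1 : Real.exp (3 / 2) ^ 2 = Real.exp 1 ^ 3 := by
    rw [← Real.exp_nat_mul, ← Real.exp_nat_mul]; norm_num
  have h2 := Real.exp_one_lt_d9
  have h3 : Real.exp 1 ^ 3 ≤ 2.7182818286 ^ 3 := by gcongr
  have h4 : Real.exp (3 / 2) ^ 2 ≤ 5 ^ 2 := by rw [h1]; norm_num at h3 ⊢; linarith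
  exact le_of_sq_le_sq h4 (by norm_num)

/-- Since `ρ / 2 ≤ T`, the exponent in `rate_le` is at most `1 / log 2 < 3 / 2`: a rate grows by a
bounded factor over the whole epoch. -/
theorem Valid.rate_le_five {s : State G κ} (hS : Setting T G C) (hs : Valid T C s) (j : Fin κ) :
    s.rate j ≤ 5 * s.eta := by
  refine (hs.rate_le j).trans ?_
  rw [mul_comm]
  refine mul_le_mul_of_nonneg_right (exp_le_five ?_) hs.eta_pos.le
  have hl := hS.one_le_log
  have h2 := Real.log_two_gt_d9
  have h3 : Real.log (s.rho j / 2) ≤ Real.log T :=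
    Real.log_le_log (by linarith [hs.two_le_rho j]) (by linarith [hs.rho_le j])
  rw [div_le_iff₀ (by positivity)]
  nlinarith

theorem Valid.mul_eta_le_one {s : State G κ} (hS : Setting T G C) (hs : Valid T C s) :
    8000 * s.eta ≤ 1 := by
  have h1 := hS.one_le_log
  have h2 := hS.two_le_log
  have h3 : (8000 : ℝ) ≤ 2000 * Real.log T * Real.log (K * T) ^ 2 := by
    have : (2 : ℝ) ^ 2 ≤ Real.log (K * T) ^ 2 := by gcongr
    nlinarith
  have := mul_le_mul_of_nonneg_left h3 hs.eta_pos.le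
  linarith [hs.eta_le]

theorem valid_restart (hS : Setting T G C) {c η : ℝ} (hc : 0 ≤ c) (hη : 0 < η)
    (hη1 : η * (2000 * Real.log T * Real.log (K * T) ^ 2) ≤ 1) :
    Valid T C (restart T G C c η) := by
  obtain ⟨m⟩ := hS.nonempty_meta
  have h1 := restart_div_le (T := T) hS.T_pos hη hc ⟨_, comparator_mem hS m⟩
  have hκ : ∀ _ : Fin κ, (1 : ℝ) ≤ κ := fun j => by
    have : 0 < κ := j.pos
    exact_mod_cast this
  have hκT : (κ : ℝ) ≤ T := by
    have h2 : (κ : ℝ) ≤ metaCard G κ := by exact_mod_cast kappa_le_metaCard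
    linarith [hS.two_mul_metaCard_le, Nat.cast_nonneg (α := ℝ) (metaCard G κ)]
  refine ⟨hη, hη1, h1.1, fun j => hedgeInit_mem hS.T_pos (hS.partition.nonempty j),
    fun _ => le_refl _, fun j => ?_, fun j => ?_, fun _ => hη, fun j => ?_, le_refl _, ?_⟩
  · change 2 ≤ 2 * (κ : ℝ); linarith [hκ j]
  · change 2 * (κ : ℝ) ≤ 2 * T; linarith
  · change η ≤ η * Real.exp (Real.log (2 * (κ : ℝ) / 2) / _)
    refine le_mul_of_one_le_right hη.le (Real.one_le_exp ?_)
    have := hS.one_le_log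
    have := Real.log_nonneg (show 1 ≤ 2 * (κ : ℝ) / 2 by linarith [hκ j])
    have := Real.log_pos one_lt_two
    positivity
  · change η * 0 < ((κ : ℝ) + 1) / η
    rw [mul_zero]; positivity

/-- The estimator for the meta-nodes in a round with choices `x`. -/
noncomputable abbrev metaEst (C : Fin κ → Finset (Fin K)) (loss : Fin K → ℝ) (s : State G κ)
    (x : Choice G κ) : Meta G κ → ℝ :=
  metaEstimator s (armEstimator C s x (feedback G loss x.2))

/-- The state after a round that does not end an epoch. -/
noncomputable def advance (T : ℕ) (G : Digraph (Fin K)) (C : Fin κ → Finset (Fin K)) (c : ℝ)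
    (loss : Fin K → ℝ) (s : State G κ) (x : Choice G κ) : State G κ :=
  let est := armEstimator C s x (feedback G loss x.2)
  let mest := metaEstimator s est
  let p' := omdStep (metaDomain T G κ) (hybridReg c s.eta s.rate) mest s.p
  { eta := s.eta
    rate := fun j => if s.rho j < 1 / p' (.inl j) then s.rate j * Real.exp (1 / Real.log T)
      else s.rate j
    rho := fun j => if s.rho j < 1 / p' (.inl j) then 2 / p' (.inl j) else s.rho j
    p := p'
    hedge := fun j => hedgeStep T (C j) (s.hedge j) est
    cumLoss := s.cumLoss + s.p ⬝ᵥ mest }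

open Classical in
theorem step_eq (c : ℝ) (loss : Fin K → ℝ) (s : State G κ) (x : Choice G κ) :
    step T G C c loss s x =
      if ((κ : ℝ) + 1) / s.eta ≤ s.eta * (s.cumLoss + s.p ⬝ᵥ metaEst C loss s x) then
        restart T G C c (s.eta / 2) else advance T G C c loss s x := by
  unfold step advance
  simp only

/-! ### Bounds for the importance-weighted estimators. -/

section Estimators

variable {loss : Fin K → ℝ} {s : State G κ}

theorem feedback_mem (hl : ∀ i, loss i ∈ Set.Icc (0 : ℝ) 1) (a i : Fin K) :
    feedback G loss a i ∈ Set.Icc (0 : ℝ) 1 := by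
  unfold feedback
  split_ifs
  · exact hl i
  · simp

open Classical in
theorem armEstimator_clique (hC : IsCliquePartition G C) (x : Choice G κ) (fb : Fin K → ℝ)
    {i : Fin K} {j : Fin κ} (hi : i ∈ C j) :
    armEstimator C s x fb i =
      if x.1 = .inl j then fb i / s.p (.inl j) else 0 := by
  have hi' := hC.mem_inNbrs hi
  obtain ⟨m, a⟩ := x
  unfold armEstimator
  rw [dif_pos hi']
  rcases m with j' | v
  · simp only [Sum.inl.injEq]
    by_cases h : j' = j
    · subst h; simp [hi]
    · have : i ∉ C j' := fun h' => h (hC.eq_of_mem h' hi)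
      simp [h, this]
  · simp

theorem armEstimator_noLoop (x : Choice G κ) (fb : Fin K → ℝ) (v : NoLoop G) :
    armEstimator C s x fb v.1 = if v.1 ≠ x.2 then fb v.1 / (1 - s.p (.inr v)) else 0 := by
  unfold armEstimator
  rw [dif_neg v.2]

variable (hC : IsCliquePartition G C) (hp : s.p ∈ metaDomain T G κ)
  (hl : ∀ i, loss i ∈ Set.Icc (0 : ℝ) 1) (x : Choice G κ)
include hC hp hl

theorem armEstimator_nonneg (i : Fin K) :
    0 ≤ armEstimator C s x (feedback G loss x.2) i := by
  have h1 := (feedback_mem (G := G) hl x.2 i).1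
  by_cases hi : i ∈ inNbrs G i
  · obtain ⟨j, hj⟩ := (hC.covers i).2 hi
    rw [armEstimator_clique hC x _ hj]
    split_ifs
    · exact div_nonneg h1 (hp.1.1 _)
    · exact le_rfl
  · rw [armEstimator_noLoop x _ ⟨i, hi⟩]
    split_ifs
    · exact div_nonneg h1 (by linarith [le_one_of_mem_metaDomain hp (.inr ⟨i, hi⟩)])
    · exact le_rfl

omit hp in
open Classical in
theorem mul_armEstimator_clique_le {i : Fin K} {j : Fin κ} (hi : i ∈ C j) :
    s.p (.inl j) * armEstimator C s x (feedback G loss x.2) i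
      ≤ if x.1 = .inl j then 1 else 0 := by
  have h1 := (feedback_mem (G := G) hl x.2 i).2
  rw [armEstimator_clique hC x _ hi]
  split_ifs
  · rcases eq_or_ne (s.p (.inl j)) 0 with h | h
    · rw [h]; simp
    · rwa [mul_div_cancel₀ _ h]
  · simp

omit hC hp in
theorem mul_armEstimator_noLoop_le (v : NoLoop G) :
    (1 - s.p (.inr v)) * armEstimator C s x (feedback G loss x.2) v.1 ≤ 1 := by
  have h1 := (feedback_mem (G := G) hl x.2 v.1).2
  rw [armEstimator_noLoop x _ v]
  split_ifs
  · rcases eq_or_ne (1 - s.p (.inr v)) 0 with h | h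
    · rw [h]; simp
    · rwa [mul_div_cancel₀ _ h]
  · simp

variable (hh : ∀ j, (s.hedge j).prob ∈ hedgeDomain T (C j))
include hh

omit hp in
open Classical in
theorem mul_metaEst_clique_le (j : Fin κ) :
    s.p (.inl j) * metaEst C loss s x (.inl j)
      ≤ if x.1 = .inl j then 1 else 0 := by
  change _ * ((s.hedge j).prob ⬝ᵥ _) ≤ _
  unfold dotProduct
  rw [mul_sum]
  calc _ ≤ ∑ i, (s.hedge j).prob i * (if x.1 = .inl j then 1 else 0) := by
        refine sum_le_sum fun i _ => ?_
        by_cases hi : i ∈ C j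
        · have := mul_le_mul_of_nonneg_left (mul_armEstimator_clique_le (s := s) hC hl x hi)
            ((hh j).1.1 i)
          linarith
        · simp [(hh j).2.2 i hi]
    _ = _ := by rw [← sum_mul, (hh j).1.2, one_mul]

theorem metaEst_nonneg (m : Meta G κ) : 0 ≤ metaEst C loss s x m := by
  rcases m with j | v
  · exact Finset.sum_nonneg (s := univ) fun i _ =>
      mul_nonneg ((hh j).1.1 i) (armEstimator_nonneg hC hp hl x i)
  · exact armEstimator_nonneg hC hp hl x v.1

theorem lossBound_metaEst : LossBound s.p (metaEst C loss s x) := by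
  refine ⟨metaEst_nonneg hC hp hl x hh, fun j => ?_, fun v => ?_⟩
  · refine (mul_metaEst_clique_le hC hl x hh j).trans ?_
    split_ifs <;> norm_num
  · exact mul_armEstimator_noLoop_le hl x v

omit hp in
-- Only the clique that was drawn has a nonzero estimate, so there is no factor `κ`.
theorem sum_mul_metaEst_clique_le :
    ∑ j, s.p (.inl j) * metaEst C loss s x (.inl j) ≤ 1 := by
  classical
  refine (sum_le_sum fun j _ => mul_metaEst_clique_le hC hl x hh j).trans ?_
  rcases x.1 with j' | v <;> simp

/-- The estimated loss of a single round exceeds that of `m` by a controlled amount. -/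
theorem dotProduct_metaEst_le (hT : 0 < T) (m : Meta G κ) :
    s.p ⬝ᵥ metaEst C loss s x ≤ 1 + 1 / s.p m
      + (match m with | .inl _ => 0 | .inr _ => metaEst C loss s x m) := by
  classical
  have hb := lossBound_metaEst hC hp hl x hh
  have hm := metaDomain_pos hT hp m
  have h1 := sum_mul_metaEst_clique_le hC hl x hh
  -- For `v` other than `m` the denominator `1 - p v` is at least `p m`.
  have hv : ∀ v : NoLoop G, m ≠ .inr v → s.p (.inr v) * metaEst C loss s x (.inr v)
      ≤ s.p (.inr v) * (1 / s.p m) := fun v hv => by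
    have h2 := metaDomain_add_le hp hv
    have h3 := hb.noLoop v
    have h4 := hb.nonneg (.inr v)
    refine mul_le_mul_of_nonneg_left ?_ (hp.1.1 _)
    rw [le_div_iff₀ hm]
    nlinarith
  have h5 : ∑ v : NoLoop G, s.p (.inr v) ≤ 1 := by
    have := hp.1.2
    rw [Fintype.sum_sum_type] at this
    linarith [sum_nonneg fun (j : Fin κ) (_ : j ∈ univ) => hp.1.1 (.inl j)]
  have h6 : (∑ v : NoLoop G, s.p (.inr v)) * (1 / s.p m) ≤ 1 / s.p m :=
    mul_le_of_le_one_left (by positivity) h5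
  unfold dotProduct
  rw [Fintype.sum_sum_type]
  rcases m with j | v₀
  · have h7 := sum_le_sum fun v (_ : v ∈ univ) => hv v (by simp)
    rw [← sum_mul] at h7
    simp only
    linarith
  · have h7 : ∑ v : NoLoop G, s.p (.inr v) * metaEst C loss s x (.inr v)
        ≤ ∑ v : NoLoop G, (s.p (.inr v) * (1 / s.p (.inr v₀))
          + if v = v₀ then metaEst C loss s x (.inr v₀) else 0) := by
      refine sum_le_sum fun v _ => ?_
      by_cases h : v = v₀
      · subst h
        have h8 := mul_le_of_le_one_left (hb.nonneg (.inr v))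
          (le_one_of_mem_metaDomain hp (.inr v))
        have h9 : 0 ≤ s.p (.inr v) * (1 / s.p (.inr v)) := by positivity
        simp only [if_true]; linarith
      · have := hv v (by simpa using fun h' => h h'.symm)
        simpa [h] using this
    rw [sum_add_distrib, ← sum_mul, sum_ite_eq', if_pos (mem_univ _)] at h7
    linarith

end Estimators

theorem Valid.lossBound (hS : Setting T G C) {s : State G κ} (hs : Valid T C s)
    {loss : Fin K → ℝ} (hl : ∀ i, loss i ∈ Set.Icc (0 : ℝ) 1) (x : Choice G κ) :
    LossBound s.p (metaEst C loss s x) :=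
  lossBound_metaEst hS.partition hs.p_mem hl x hs.hedge_mem

theorem Valid.omdStep (hS : Setting T G C) {c : ℝ} (hc : 4 ≤ c) {s : State G κ}
    (hs : Valid T C s) {loss : Fin K → ℝ} (hl : ∀ i, loss i ∈ Set.Icc (0 : ℝ) 1)
    (x : Choice G κ) :
    (advance T G C c loss s x).p ∈ metaDomain T G κ ∧ ∀ u ∈ metaDomain T G κ,
      s.p ⬝ᵥ metaEst C loss s x - u ⬝ᵥ metaEst C loss s x ≤ hybridDiv c s.eta s.rate u s.p
        - hybridDiv c s.eta s.rate u (advance T G C c loss s x).p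
        + 40 * s.eta * (s.p ⬝ᵥ metaEst C loss s x) :=
  hybrid_omdStep hS.T_pos hs.eta_pos (by linarith [hs.mul_eta_le_one hS, hs.eta_pos]) hc
    hs.rate_pos (hs.rate_le_five hS) hs.p_mem (hs.lossBound hS hl x)

theorem Valid.step (hS : Setting T G C) {c : ℝ} (hc : 4 ≤ c) {s : State G κ}
    (hs : Valid T C s) {loss : Fin K → ℝ} (hl : ∀ i, loss i ∈ Set.Icc (0 : ℝ) 1)
    (x : Choice G κ) : Valid T C (step T G C c loss s x) := by
  classical
  rw [step_eq]
  split_ifs with hr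
  · refine valid_restart hS (by linarith) (half_pos hs.eta_pos) (le_trans ?_ hs.eta_le)
    have := hS.one_le_log
    have := hs.eta_pos
    gcongr
    linarith
  · have hp' := (hs.omdStep hS hc hl x).1
    set p' := (advance T G C c loss s x).p with hp'_def
    have hl1 := hS.one_le_log
    have hln2 := Real.log_pos one_lt_two
    have hpos := metaDomain_pos hS.T_pos hp'
    have hT0 : (0 : ℝ) < T := by linarith [hS.four_le_cast]
    have hinv : ∀ m, 1 / p' m ≤ T := fun m => by
      rw [div_le_iff₀ (hpos m)]
      have := hp'.2 m
      rw [div_le_iff₀ hT0] at this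
      linarith
    have h2 : ∀ m, 2 / p' m = 2 * (1 / p' m) := fun m => by ring
    have hV : ∀ j, 0 ≤ (s.hedge j).sqSum + ∑ i, (s.hedge j).prob i *
        armEstimator C s x (feedback G loss x.2) i ^ 2 := fun j =>
      add_nonneg (hs.sqSum_nonneg j) (sum_nonneg fun i _ =>
        mul_nonneg ((hs.hedge_mem j).1.1 i) (sq_nonneg _))
    refine ⟨hs.eta_pos, hs.eta_le, hp', fun j => ?_, fun j => ?_, fun j => ?_, fun j => ?_,
      fun j => ?_, fun j => ?_, ?_, lt_of_not_ge hr⟩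
    · exact (hedge_omdStep hS.T_pos (Real.sqrt_pos.2 (one_div_pos.2 (by
        linarith [hV j]))) (hs.hedge_mem j) (armEstimator_nonneg hS.partition hs.p_mem hl x)).1
    · exact hV j
    · change 2 ≤ if s.rho j < 1 / p' (.inl j) then 2 / p' (.inl j) else s.rho j
      have := hs.two_le_rho j
      split_ifs with h
      · rw [h2]; linarith
      · exact this
    · change (if s.rho j < 1 / p' (.inl j) then 2 / p' (.inl j) else s.rho j) ≤ 2 * T
      split_ifs with h
      · rw [h2]; linarith [hinv (.inl j)]
      · exact hs.rho_le j
    · change 0 < if s.rho j < 1 / p' (.inl j) then s.rate j * Real.exp (1 / Real.log T)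
        else s.rate j
      have := hs.rate_pos j
      split_ifs <;> positivity
    · change (if s.rho j < 1 / p' (.inl j) then s.rate j * Real.exp (1 / Real.log T)
        else s.rate j) ≤ s.eta * Real.exp (Real.log ((if s.rho j < 1 / p' (.inl j) then
          2 / p' (.inl j) else s.rho j) / 2) / (Real.log 2 * Real.log T))
      have h3 := hs.two_le_rho j
      split_ifs with h
      · refine (mul_le_mul_of_nonneg_right (hs.rate_le j) (Real.exp_pos _).le).trans ?_
        rw [mul_assoc, ← Real.exp_add]
        -- An update at least doubles `ρ`, so the bound on the rate gains the factor `exp (1 / log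
        -- T)` by which the rate is multiplied.
        have h4 : Real.log (s.rho j / 2) + Real.log 2 ≤ Real.log (2 / p' (.inl j) / 2) := by
          rw [← Real.log_mul (by linarith) two_ne_zero]
          exact Real.log_le_log (by linarith) (by rw [h2]; linarith)
        have h5 : Real.log (s.rho j / 2) / (Real.log 2 * Real.log T) + 1 / Real.log T
            = (Real.log (s.rho j / 2) + Real.log 2) / (Real.log 2 * Real.log T) := by
          field_simp
        rw [h5]
        have := hs.eta_pos
        gcongr
      · exact hs.rate_le j
    · change 0 ≤ s.cumLoss + s.p ⬝ᵥ metaEst C loss s x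
      have := hs.cum_nonneg
      have : 0 ≤ s.p ⬝ᵥ metaEst C loss s x := sum_nonneg fun m _ =>
        mul_nonneg (hs.p_mem.1.1 m) ((hs.lossBound hS hl x).nonneg m)
      linarith

end

/-! ### Progress of the meta-algorithm within an epoch. -/

section

variable {K κ T : ℕ} {G : Digraph (Fin K)} {C : Fin κ → Finset (Fin K)}

/-- The scale of the regret in an epoch with learning rate `η`. -/
noncomputable def epochScale (G : Digraph (Fin K)) (κ : ℕ) (c η : ℝ) : ℝ :=
  (κ + 1) / η + c * metaCard G κ

/-- The gain from the increasing learning rate of the meta-node `m`. -/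
noncomputable def rateGain (T : ℕ) (s : State G κ) : Meta G κ → ℝ
  | .inl j => (s.rho j / 80 - Real.log (s.rho j) / 10) / (s.eta * Real.log T)
  | .inr _ => 0

/-- The progress of the meta-algorithm in an epoch, compared to `m`: here `U` is the loss of the
comparator. -/
def MetaInv (T : ℕ) (c : ℝ) (m : Meta G κ) (s : State G κ) (U : ℝ) : Prop :=
  s.cumLoss - U + hybridDiv c s.eta s.rate (comparator T m) s.p + rateGain T s m
    ≤ 2 * epochScale G κ c s.eta * Real.log T + 40 * s.eta * s.cumLoss

theorem metaInv_restart (hS : Setting T G C) {c η : ℝ} (hc : 0 ≤ c) (hη : 0 < η)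
    (m : Meta G κ) : MetaInv T c m (restart T G C c η) 0 := by
  have h1 := (restart_div_le hS.T_pos hη hc ⟨_, comparator_mem hS m⟩).2 _ (comparator_mem hS m)
  have hl := hS.one_le_log
  have hS0 : (κ + 1) / η ≤ epochScale G κ c η := by
    unfold epochScale
    have : 0 ≤ c * metaCard G κ := by positivity
    linarith
  have hS1 : 0 ≤ (κ + 1) / η := by positivity
  -- The initial `ρ = 2 κ` already counts as gain. Paying for it uses the second of the two copies
  -- of `epochScale * log T` in the invariant.
  have h2 : rateGain T (restart T G C c η) m ≤ epochScale G κ c η * Real.log T := by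
    refine le_trans ?_ (le_mul_of_one_le_right (hS1.trans hS0) hl)
    rcases m with j | v
    · change (2 * (κ : ℝ) / 80 - Real.log (2 * κ) / 10) / (η * Real.log T) ≤ _
      refine le_trans ?_ hS0
      have hκ : (1 : ℝ) ≤ κ := by
        have : 0 < κ := j.pos
        exact_mod_cast this
      have := Real.log_nonneg (show 1 ≤ 2 * (κ : ℝ) by linarith)
      exact div_le_div₀ (by linarith) (by linarith) hη (le_mul_of_one_le_right hη.le hl)
    · exact hS1.trans hS0
  change (0 : ℝ) - 0 + hybridDiv c η (fun _ => η) _ _ + _ ≤ 2 * epochScale G κ c η * _ + 40 * η * 0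
  change _ ≤ epochScale G κ c η * _ at h1
  change hybridDiv c η (fun _ => η) _ (restart T G C c η).p ≤ _ at h1
  linarith

theorem inv_sub_le_barrierGap {u p : ℝ} (hu : 1 / 2 ≤ u) (hp : 0 < p) :
    1 / (4 * p) - Real.log 2 ≤ barrierGap (u / p) := by
  have h1 := half_sub_le_barrierGap (div_pos (by linarith : 0 < u) hp)
  have h2 : 1 / (4 * p) ≤ u / p / 2 := by
    rw [div_div, div_le_div_iff₀ (by positivity) (by positivity)]
    nlinarith
  linarith

theorem inv_sub_inv_mul_exp_ge {r x : ℝ} (hr : 0 < r) (hx : 0 ≤ x) (hx1 : x ≤ 1) :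
    1 / r * (x / 2) ≤ 1 / r - 1 / (r * Real.exp x) := by
  have h1 : Real.exp (-x) ≤ 1 - x / 2 := by
    rw [Real.exp_neg]
    have h2 := Real.add_one_le_exp x
    rw [inv_le_comm₀ (Real.exp_pos x) (by linarith)]
    refine le_trans ?_ h2
    rw [inv_le_iff_one_le_mul₀ (by linarith)]
    nlinarith
  have h3 : 1 / (r * Real.exp x) = 1 / r * Real.exp (-x) := by
    rw [Real.exp_neg]; field_simp
  rw [h3]
  have := mul_le_mul_of_nonneg_left h1 (one_div_pos.2 hr).le
  linarith

/-- When the rate of `j` is raised, `1 / rate` drops by at least `1 / (10 η log T)`, and the barrier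
gap it multiplies is at least `1 / (4 p') - log 2 = ρ' / 8 - log 2`, with `ρ' = 2 / p'` the new
threshold. The divergence thus releases enough to raise the gain to the level of `ρ'`. Rates never
decrease, so the other coordinates only help. -/
theorem hybridDiv_advance_add_rateGain_le (hS : Setting T G C) {c : ℝ} (hc : 4 ≤ c)
    {s : State G κ} (hs : Valid T C s) {loss : Fin K → ℝ}
    (hl : ∀ i, loss i ∈ Set.Icc (0 : ℝ) 1) (x : Choice G κ) (m : Meta G κ) :
    hybridDiv c s.eta (advance T G C c loss s x).rate (comparator T m)
        (advance T G C c loss s x).p + rateGain T (advance T G C c loss s x) m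
      ≤ hybridDiv c s.eta s.rate (comparator T m) (advance T G C c loss s x).p
        + rateGain T s m := by
  set s' := advance T G C c loss s x with hs'
  have hp' := (hs.omdStep hS hc hl x).1
  have hpos := metaDomain_pos hS.T_pos hp'
  have hupos := metaDomain_pos hS.T_pos (comparator_mem hS m)
  have hlog := hS.one_le_log
  have hrate : ∀ j, s'.rate j = if s.rho j < 1 / s'.p (.inl j) then
      s.rate j * Real.exp (1 / Real.log T) else s.rate j := fun _ => rfl
  have hrho : ∀ j, s'.rho j = if s.rho j < 1 / s'.p (.inl j) then 2 / s'.p (.inl j)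
      else s.rho j := fun _ => rfl
  have hb : ∀ m', 0 ≤ barrierGap (comparator T m m' / s'.p m') := fun m' =>
    barrierGap_nonneg (div_pos (hupos m') (hpos m'))
  have hx0 : 0 ≤ 1 / Real.log T := by positivity
  have hx1 : 1 / Real.log T ≤ 1 := by rw [div_le_one (by linarith)]; exact hlog
  have hterm : ∀ j, 0 ≤ (1 / s.rate j - 1 / s'.rate j)
      * barrierGap (comparator T m (.inl j) / s'.p (.inl j)) := fun j => by
    refine mul_nonneg ?_ (hb _)
    rw [hrate]
    have hr := hs.rate_pos j
    split_ifs
    · exact le_trans (by positivity) (inv_sub_inv_mul_exp_ge hr hx0 hx1)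
    · simp
  have hdiff : hybridDiv c s.eta s.rate (comparator T m) s'.p
      - hybridDiv c s.eta s'.rate (comparator T m) s'.p
      = ∑ j, (1 / s.rate j - 1 / s'.rate j)
        * barrierGap (comparator T m (.inl j) / s'.p (.inl j)) := by
    unfold hybridDiv
    simp only [sub_mul, sum_sub_distrib]
    ring
  suffices h : rateGain T s' m - rateGain T s m ≤ ∑ j, (1 / s.rate j - 1 / s'.rate j)
      * barrierGap (comparator T m (.inl j) / s'.p (.inl j)) by linarith
  rcases m with j | v
  · refine le_trans ?_ (single_le_sum (fun j _ => hterm j) (mem_univ j))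
    change (s'.rho j / 80 - Real.log (s'.rho j) / 10) / (s.eta * Real.log T)
      - (s.rho j / 80 - Real.log (s.rho j) / 10) / (s.eta * Real.log T) ≤ _
    rw [hrate, hrho]
    split_ifs with h
    · have hr := hs.rate_pos j
      have hr5 := hs.rate_le_five hS j
      have hη := hs.eta_pos
      have hq : 0 < s'.p (.inl j) := hpos _
      have h2 := hs.two_le_rho j
      have h3 := inv_sub_inv_mul_exp_ge hr hx0 hx1
      have h4 := inv_sub_le_barrierGap (half_le_comparator hS (.inl j)) hq
      have h5 : 1 / (5 * s.eta) ≤ 1 / s.rate j := one_div_le_one_div_of_le hr hr5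
      have h6 : 1 / (10 * (s.eta * Real.log T)) ≤ 1 / s.rate j
          - 1 / (s.rate j * Real.exp (1 / Real.log T)) := by
        refine le_trans ?_ h3
        calc 1 / (10 * (s.eta * Real.log T)) = 1 / (5 * s.eta) * (1 / Real.log T / 2) := by
              field_simp; norm_num
          _ ≤ _ := by gcongr
      refine le_trans ?_ (mul_le_mul_of_nonneg_right h6 (hb (.inl j)))
      rw [← sub_div, div_le_iff₀ (by positivity)]
      have h7 : 1 / (10 * (s.eta * Real.log T))
          * barrierGap (comparator (G := G) T (.inl j) (.inl j) / s'.p (.inl j)) * (s.eta * Real.log T)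
          = barrierGap (comparator (G := G) T (.inl j) (.inl j) / s'.p (.inl j)) / 10 := by
        field_simp
      rw [h7]
      -- `ρ` at least doubles, so the term `-log ρ / 10` in the gain compensates for the `log 2`
      -- lost in the barrier gap.
      have h8 : Real.log (s.rho j) + Real.log 2 ≤ Real.log (2 / s'.p (.inl j)) := by
        rw [← Real.log_mul (by linarith) two_ne_zero]
        refine Real.log_le_log (by linarith) ?_
        have : 2 / s'.p (.inl j) = 2 * (1 / s'.p (.inl j)) := by ring
        linarith
      have h9 : 1 / (4 * s'.p (.inl j)) = 2 / s'.p (.inl j) / 8 := by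
        field_simp; norm_num
      rw [h9] at h4
      linarith
    · simp
  · refine le_trans ?_ (sum_nonneg fun j _ => hterm j)
    simp [rateGain]

theorem MetaInv.advance (hS : Setting T G C) {c : ℝ} (hc : 4 ≤ c) {s : State G κ}
    (hs : Valid T C s) {loss : Fin K → ℝ} (hl : ∀ i, loss i ∈ Set.Icc (0 : ℝ) 1)
    (x : Choice G κ) {m : Meta G κ} {U : ℝ} (h : MetaInv T c m s U) :
    MetaInv T c m (advance T G C c loss s x)
      (U + comparator T m ⬝ᵥ metaEst C loss s x) := by
  have h1 := (hs.omdStep hS hc hl x).2 _ (comparator_mem hS m)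
  have h2 := hybridDiv_advance_add_rateGain_le hS hc hs hl x m
  unfold MetaInv at h ⊢
  change s.cumLoss + s.p ⬝ᵥ metaEst C loss s x - _ + hybridDiv c s.eta _ _ _ + _
    ≤ 2 * epochScale G κ c s.eta * _ + 40 * s.eta * (s.cumLoss + s.p ⬝ᵥ metaEst C loss s x)
  linarith

/-- The part of the gain from the increasing learning rate of the meta-node `m` that compensates
for the regret of its Hedge instance. -/
noncomputable def rhoGain (T : ℕ) (s : State G κ) : Meta G κ → ℝ
  | .inl j => s.rho j / (80 * s.eta * Real.log T)
  | .inr _ => 0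

/-- The consequence of the invariant: the regret in the epoch is small, even when one more round
is added. -/
theorem MetaInv.le (hS : Setting T G C) {c : ℝ} (hc : 8 ≤ c) {s : State G κ}
    (hs : Valid T C s) {m : Meta G κ} {U : ℝ} (h : MetaInv T c m s U) :
    s.cumLoss - U + 2 * (1 / s.p m) + rhoGain T s m
      ≤ 2 * epochScale G κ c s.eta * Real.log T + 47 * epochScale G κ c s.eta := by
  have hη := hs.eta_pos
  have hη' := hs.mul_eta_le_one hS
  have hlog := hS.one_le_log
  have hp := metaDomain_pos hS.T_pos hs.p_mem
  have hln2 := Real.log_two_lt_d9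
  have hκ : (0 : ℝ) ≤ κ := Nat.cast_nonneg κ
  have hSη : 1 / s.eta ≤ epochScale G κ c s.eta := by
    have h2 : 1 / s.eta ≤ (κ + 1) / s.eta := by gcongr; linarith
    have h3 : 0 ≤ c * metaCard G κ := by positivity
    unfold epochScale; linarith
  have h1η : 1 ≤ 1 / s.eta := by rw [le_div_iff₀ hη]; linarith
  have h5η : 8 ≤ 1 / (5 * s.eta) := by rw [le_div_iff₀ (by positivity)]; linarith
  -- The epoch is still running, so the restart test bounds the accumulated stability cost.
  have hcum : 40 * s.eta * s.cumLoss ≤ 40 * epochScale G κ c s.eta := by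
    have h2 := hs.cum_lt
    have h3 : 0 ≤ c * metaCard G κ := by positivity
    unfold epochScale; linarith
  -- Weight 8 on a gap of at least `1 / (4 p) - log 2` yields the `2 / p` of the statement, at a
  -- cost `8 * log 2 ≤ 6`; together with 40 for stability and 1 for the logarithm of `ρ` this makes
  -- 47.
  have hD := mul_barrierGap_le_hybridDiv (a := 8) (c := c) hη (by linarith) hs.rate_pos
    (metaDomain_pos hS.T_pos (comparator_mem hS m)) hp m (by
      rcases m with j | v
      · exact h5η.trans (one_div_le_one_div_of_le (hs.rate_pos j) (hs.rate_le_five hS j))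
      · exact hc)
  have hgap := inv_sub_le_barrierGap (half_le_comparator hS m) (hp m)
  have e1 : 1 / (4 * s.p m) = 1 / s.p m / 4 := by rw [div_div, mul_comm]
  rw [e1] at hgap
  have hgain : rhoGain T s m ≤ rateGain T s m + epochScale G κ c s.eta := by
    rcases m with j | v
    · change s.rho j / (80 * s.eta * Real.log T)
        ≤ (s.rho j / 80 - Real.log (s.rho j) / 10) / (s.eta * Real.log T) + _
      have h2 : Real.log (s.rho j) ≤ 2 * Real.log T := by
        have h3 := Real.log_le_log (by linarith [hs.two_le_rho j]) (hs.rho_le j)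
        have hT := hS.four_le_cast
        have h4 := Real.log_le_log two_pos (show (2 : ℝ) ≤ T by linarith)
        rw [Real.log_mul two_ne_zero (by linarith)] at h3
        linarith
      have h3 : (s.rho j / 80 - Real.log (s.rho j) / 10) / (s.eta * Real.log T)
          = s.rho j / (80 * s.eta * Real.log T)
            - Real.log (s.rho j) / (10 * (s.eta * Real.log T)) := by
        field_simp
      have h4 : Real.log (s.rho j) / (10 * (s.eta * Real.log T)) ≤ 1 / s.eta := by
        rw [div_le_div_iff₀ (by positivity) hη]
        nlinarith [mul_pos hη (show 0 < Real.log T by linarith)]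
      linarith
    · change (0 : ℝ) ≤ 0 + _
      linarith
  unfold MetaInv at h
  linarith

/-! ### Epochs compared to a node without a self-loop -/

/-- The nonnegative slack of a round: the excess loss of the comparators, when `mix` is the
distribution that the comparator of Hedge is mixed with. -/
noncomputable def slack (T : ℕ) (C : Fin κ → Finset (Fin K)) (mix loss : Fin K → ℝ)
    (s : State G κ) (x : Choice G κ) : ℝ :=
  1 / T * (∑ m, metaEst C loss s x m
    + mix ⬝ᵥ armEstimator C s x (feedback G loss x.2))

/-- The estimated loss of arm `i` in a round. -/
noncomputable abbrev armEst (C : Fin κ → Finset (Fin K)) (i : Fin K) (loss : Fin K → ℝ)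
    (s : State G κ) (x : Choice G κ) : ℝ :=
  armEstimator C s x (feedback G loss x.2) i

/-- A property of the states in an epoch, of the estimated loss of arm `i` so far, and of
the slack so far, that bounds the regret in the epoch by `Q` times its scale. -/
structure EpochBound (T : ℕ) (C : Fin κ → Finset (Fin K)) (c Q : ℝ) (i : Fin K)
    (mix : Fin K → ℝ) (P : State G κ → ℝ → ℝ → Prop) : Prop where
  start : ∀ η, 0 < η → P (restart T G C c η) 0 0
  advance : ∀ s Y W loss x, Valid T C s → (∀ i, loss i ∈ Set.Icc (0 : ℝ) 1) → P s Y W →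
    P (advance T G C c loss s x) (Y + armEst C i loss s x) (W + slack T C mix loss s x)
  le : ∀ s Y W, Valid T C s → P s Y W → s.cumLoss - Y ≤ Q * epochScale G κ c s.eta + W
  le_add : ∀ s Y W loss x, Valid T C s → (∀ i, loss i ∈ Set.Icc (0 : ℝ) 1) → P s Y W →
    s.cumLoss + s.p ⬝ᵥ metaEst C loss s x - (Y + armEst C i loss s x)
      ≤ Q * epochScale G κ c s.eta + W

theorem one_le_epochScale (hS : Setting T G C) {c : ℝ} (hc : 0 ≤ c) {s : State G κ}
    (hs : Valid T C s) : 1 ≤ epochScale G κ c s.eta := by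
  have hη := hs.eta_pos
  have h1 : 1 ≤ (κ + 1) / s.eta := by
    rw [le_div_iff₀ hη]
    linarith [hs.mul_eta_le_one hS, Nat.cast_nonneg (α := ℝ) κ]
  have h3 : 0 ≤ c * metaCard G κ := by positivity
  unfold epochScale; linarith

theorem epochBound_noLoop (hS : Setting T G C) {c : ℝ} (hc : 8 ≤ c) (v : NoLoop G) :
    EpochBound T C c (800 * Real.log (K * T) ^ 3) v.1 0
      fun s Y W => ∃ U, MetaInv T c (.inr v) s U ∧ U ≤ Y + W := by
  have hl1 := hS.one_le_log
  have hL2 := hS.two_le_log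
  have hlL := hS.log_le_log
  have hQ : 2 * Real.log T + 48 ≤ 800 * Real.log (K * T) ^ 3 := by
    have : (2 : ℝ) ^ 2 ≤ Real.log (K * T) ^ 2 := by gcongr
    nlinarith
  have key : ∀ (s : State G κ) Y W, Valid T C s →
      (∃ U, MetaInv T c (.inr v) s U ∧ U ≤ Y + W) →
      s.cumLoss - Y + 2 * (1 / s.p (.inr v)) + 1
        ≤ 800 * Real.log (K * T) ^ 3 * epochScale G κ c s.eta + W := by
    rintro s Y W hs ⟨U, hU, hle⟩
    have h1 := hU.le hS hc hs
    simp only [rhoGain, add_zero] at h1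
    have h2 := one_le_epochScale hS (c := c) (by linarith) hs
    have h3 := mul_le_mul_of_nonneg_right hQ (zero_le_one.trans h2)
    linarith
  refine ⟨fun η hη => ⟨0, metaInv_restart hS (by linarith) hη _, by simp⟩, ?_, ?_, ?_⟩
  · rintro s Y W loss x hs hl ⟨U, hU, hle⟩
    refine ⟨_, hU.advance hS (by linarith) hs hl x, ?_⟩
    have h1 := comparator_dotProduct_le (T := T) (.inr v) (hs.lossBound hS hl x).nonneg
    have h2 : slack T C 0 loss s x = 1 / T * ∑ m, metaEst C loss s x m := by simp [slack]
    rw [h2]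
    change _ ≤ armEst C v.1 loss s x + _ at h1
    linarith
  · intro s Y W hs h
    have h1 := key s Y W hs h
    have h2 := one_div_pos.2 (metaDomain_pos hS.T_pos hs.p_mem (.inr v))
    linarith
  · intro s Y W loss x hs hl h
    have h1 := key s Y W hs h
    have h2 := one_div_pos.2 (metaDomain_pos hS.T_pos hs.p_mem (.inr v))
    -- The estimate of `v` itself may be huge in this round, but it is also charged to the
    -- comparator and cancels.
    have h3 := dotProduct_metaEst_le hS.partition hs.p_mem hl x hs.hedge_mem hS.T_pos (.inr v)
    change _ ≤ _ + armEst C v.1 loss s x at h3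
    linarith

/-! ### Epochs compared to an arm in a clique -/

/-- The comparator of a Hedge instance: the arm `i`, mixed with the uniform distribution. -/
noncomputable def hedgeComparator (T : ℕ) (C : Finset (Fin K)) (i : Fin K) : Fin K → ℝ :=
  fun i' => (if i' = i then 1 - 1 / (T : ℝ) else 0) + 1 / T * (hedgeInit C).prob i'

theorem hedgeComparator_mem {C : Finset (Fin K)} (hT : 0 < T) {i : Fin K} (hi : i ∈ C) :
    hedgeComparator T C i ∈ hedgeDomain T C := by
  have h0 := hedgeInit_mem hT ⟨i, hi⟩
  have hT1 : (1 : ℝ) ≤ T := by exact_mod_cast hT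
  have h1 : 0 ≤ 1 - 1 / (T : ℝ) := by
    rw [sub_nonneg, div_le_one (by linarith)]; exact hT1
  have h2 : ∀ i', 1 / T * (hedgeInit C).prob i' ≤ hedgeComparator T C i i' := fun i' => by
    unfold hedgeComparator
    split_ifs <;> linarith
  refine ⟨⟨fun i' => le_trans (mul_nonneg (by positivity) (h0.1.1 i')) (h2 i'), ?_⟩,
    fun i' hi' => ?_, fun i' hi' => ?_⟩
  · simp only [hedgeComparator, sum_add_distrib, sum_ite_eq', mem_univ, if_true, ← mul_sum,
      h0.1.2]
    ring
  · refine le_trans ?_ (h2 i')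
    simp only [hedgeInit, hi', if_true]
    rw [mul_comm, ← one_div_mul_one_div]
  · have : i' ≠ i := fun h => hi' (h ▸ hi)
    simp [hedgeComparator, this, h0.2.2 i' hi']

theorem hedgeComparator_dotProduct_le (C : Finset (Fin K)) (i : Fin K) {g : Fin K → ℝ}
    (hg : ∀ i, 0 ≤ g i) :
    hedgeComparator T C i ⬝ᵥ g ≤ g i + 1 / T * ((hedgeInit C).prob ⬝ᵥ g) := by
  have h1 : hedgeComparator T C i ⬝ᵥ g
      = (1 - 1 / (T : ℝ)) * g i + 1 / T * ((hedgeInit C).prob ⬝ᵥ g) := by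
    simp only [hedgeComparator, dotProduct, add_mul, sum_add_distrib, mul_sum, ite_mul, zero_mul,
      sum_ite_eq', mem_univ, if_true, mul_assoc]
  rw [h1]
  have h2 : 0 ≤ 1 / (T : ℝ) := by positivity
  nlinarith [hg i]

/-- A bound for `1 / p` at the beginning of an epoch. -/
noncomputable def startBound (T : ℕ) (G : Digraph (Fin K)) (κ : ℕ) (c η : ℝ) : ℝ :=
  4 * (η * (epochScale G κ c η * Real.log T) + 1)

/-- The state of an epoch compared to the arm `i` in clique `j`: here `Y` is the estimated loss of
`i`, and `X` that of the Hedge instance `j`. -/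
structure CliqueInv (T : ℕ) (C : Fin κ → Finset (Fin K)) (c : ℝ) (j : Fin κ) (i : Fin K)
    (s : State G κ) (Y W X U U' W₁ W₂ : ℝ) : Prop where
  meta_inv : MetaInv T c (.inl j) s U
  hedge_inv : HedgeInv T (C j) (hedgeComparator T (C j) i) (s.hedge j) X U'
  U_le : U ≤ X + W₁
  U'_le : U' ≤ Y + W₂
  W₁_nonneg : 0 ≤ W₁
  W_eq : W = W₁ + W₂
  X_nonneg : 0 ≤ X
  sqSum_le : (s.hedge j).sqSum ≤ (s.rho j + startBound T G κ c s.eta) * X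
  inv_le : 1 / s.p (.inl j) ≤ s.rho j + startBound T G κ c s.eta

/-- The starting distribution need not be uniform, so `1 / p_j` can exceed `ρ = 2 κ`. Its divergence
to the comparator is bounded, and this gives the additional `startBound`. -/
theorem cliqueInv_restart (hS : Setting T G C) {c η : ℝ} (hc : 0 ≤ c) (hη : 0 < η) {j : Fin κ}
    {i : Fin K} (hi : i ∈ C j) :
    CliqueInv T C c j i (restart T G C c η) 0 0 0 0 0 0 0 := by
  refine ⟨metaInv_restart hS hc hη _, hedgeInv_init hS.T_pos (hS.partition.nonempty j)
    (hedgeComparator_mem hS.T_pos hi), by simp, by simp, le_rfl, by simp, le_rfl,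
    by simp [restart, hedgeInit], ?_⟩
  have h1 := restart_div_le hS.T_pos hη hc ⟨_, comparator_mem (G := G) hS (.inl j)⟩
  have h2 := h1.2 _ (comparator_mem hS (.inl j))
  have hp := metaDomain_pos hS.T_pos h1.1
  have h3 := mul_barrierGap_le_hybridDiv (a := 1 / η) (c := c) (rate := fun _ : Fin κ => η) hη hc
    (fun _ => hη) (metaDomain_pos hS.T_pos (comparator_mem hS (.inl j))) hp (.inl j) le_rfl
  have h4 := inv_sub_le_barrierGap (half_le_comparator hS (.inl j)) (hp (.inl j))
  change 1 / (argminOn (metaDomain T G κ) (hybridReg c η fun _ => η)) (.inl j)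
    ≤ 2 * (κ : ℝ) + startBound T G κ c η
  set q := (argminOn (metaDomain T G κ) (hybridReg c η fun _ => η)) (.inl j)
  have h5 := h3.trans h2
  rw [one_div, inv_mul_le_iff₀ hη] at h5
  have e1 : 1 / (4 * q) = 1 / q / 4 := by rw [div_div, mul_comm]
  rw [e1] at h4
  have := Real.log_two_lt_d9
  have hκ : (0 : ℝ) ≤ κ := Nat.cast_nonneg κ
  unfold startBound epochScale
  linarith

theorem startBound_nonneg {c : ℝ} (hc : 0 ≤ c) (hS : Setting T G C) {s : State G κ}
    (hs : Valid T C s) : 0 ≤ startBound T G κ c s.eta := by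
  have h1 := one_le_epochScale hS hc hs
  have h2 := hS.one_le_log
  have h3 := hs.eta_pos
  unfold startBound
  positivity

theorem CliqueInv.advance (hS : Setting T G C) {c : ℝ} (hc : 4 ≤ c) {s : State G κ}
    (hs : Valid T C s) {loss : Fin K → ℝ} (hl : ∀ i, loss i ∈ Set.Icc (0 : ℝ) 1)
    (x : Choice G κ) {j : Fin κ} {i : Fin K} (hi : i ∈ C j) {Y W X U U' W₁ W₂ : ℝ}
    (h : CliqueInv T C c j i s Y W X U U' W₁ W₂) :
    ∃ X U U' W₁ W₂, CliqueInv T C c j i (advance T G C c loss s x)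
      (Y + armEst C i loss s x) (W + slack T C (hedgeInit (C j)).prob loss s x)
      X U U' W₁ W₂ := by
  have hb := hs.lossBound hS hl x
  have hest := armEstimator_nonneg hS.partition hs.p_mem hl x
  have h1 := comparator_dotProduct_le (T := T) (.inl j) hb.nonneg
  have h2 := hedgeComparator_dotProduct_le (T := T) (C j) i hest
  have hp := metaDomain_pos hS.T_pos hs.p_mem
  have hp' := metaDomain_pos hS.T_pos (hs.omdStep hS hc hl x).1
  have hrho : s.rho j ≤ (GraphBandit.advance T G C c loss s x).rho j ∧
      1 / (GraphBandit.advance T G C c loss s x).p (.inl j)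
        ≤ (GraphBandit.advance T G C c loss s x).rho j := by
    change _ ≤ (if s.rho j < 1 / (GraphBandit.advance T G C c loss s x).p (.inl j) then
      2 / (GraphBandit.advance T G C c loss s x).p (.inl j) else s.rho j) ∧
      _ ≤ if s.rho j < 1 / (GraphBandit.advance T G C c loss s x).p (.inl j) then
      2 / (GraphBandit.advance T G C c loss s x).p (.inl j) else s.rho j
    have h3 := one_div_pos.2 (hp' (.inl j))
    have h4 : 2 / (GraphBandit.advance T G C c loss s x).p (.inl j)
      = 2 * (1 / (GraphBandit.advance T G C c loss s x).p (.inl j)) := by ring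
    split_ifs with h5
    · rw [h4]; constructor <;> linarith
    · exact ⟨le_rfl, not_lt.1 h5⟩
  have hsb := startBound_nonneg (c := c) (by linarith) hS hs
  have hmj : 0 ≤ metaEst C loss s x (.inl j) := hb.nonneg _
  have hsum : 0 ≤ ∑ m, metaEst C loss s x m := sum_nonneg fun m _ => hb.nonneg m
  -- One factor of the square is bounded by `1 / p_j`. This ties the variance of Hedge to `ρ` times
  -- its loss.
  have hV : ∑ i, (s.hedge j).prob i * armEstimator C s x (feedback G loss x.2) i ^ 2
      ≤ 1 / s.p (.inl j) * metaEst C loss s x (.inl j) := by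
    change _ ≤ _ * ∑ i, (s.hedge j).prob i * armEstimator C s x (feedback G loss x.2) i
    rw [mul_sum]
    refine sum_le_sum fun i' _ => ?_
    by_cases hi' : i' ∈ C j
    · have h3 := mul_armEstimator_clique_le (s := s) hS.partition hl x hi'
      have h4 : armEstimator C s x (feedback G loss x.2) i' ≤ 1 / s.p (.inl j) := by
        rw [le_div_iff₀ (hp _), mul_comm]
        exact h3.trans (by split_ifs <;> norm_num)
      have h5 := mul_le_mul_of_nonneg_left h4
        (mul_nonneg ((hs.hedge_mem j).1.1 i') (hest i'))
      linarith
    · simp [(hs.hedge_mem j).2.2 i' hi']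
  refine ⟨X + metaEst C loss s x (.inl j), _, _, W₁ + 1 / T * ∑ m, metaEst C loss s x m,
    W₂ + 1 / T * ((hedgeInit (C j)).prob ⬝ᵥ armEstimator C s x (feedback G loss x.2)),
    h.meta_inv.advance hS hc hs hl x,
    h.hedge_inv.step hS.T_pos (hedgeComparator_mem hS.T_pos hi) hest, ?_, ?_, ?_, ?_, ?_, ?_, ?_⟩
  · linarith [h.U_le]
  · linarith [h.U'_le]
  · have := h.W₁_nonneg
    positivity
  · rw [h.W_eq]; unfold slack; ring
  · linarith [h.X_nonneg]
  · change (s.hedge j).sqSum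
      + ∑ i, (s.hedge j).prob i * armEstimator C s x (feedback G loss x.2) i ^ 2
      ≤ (_ + startBound T G κ c s.eta) * _
    have h3 := h.sqSum_le
    have h4 := mul_le_mul_of_nonneg_right h.inv_le hmj
    have h5 : 0 ≤ X + metaEst C loss s x (.inl j) := by linarith [h.X_nonneg]
    have h6 := mul_le_mul_of_nonneg_right hrho.1 h5
    linarith
  · change _ ≤ _ + startBound T G κ c s.eta
    linarith [hrho.2]

/-- AM-GM applied to `3 L √(ρ X)`. It is used with `a = η log T`, for which `ρ / (160 a)` is half of
`rhoGain`. -/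
theorem mul_sqrt_one_add_le {a ρ X V L : ℝ} (ha : 0 < a) (hρ : 0 ≤ ρ) (hX : 0 ≤ X)
    (hV : V ≤ ρ * X) (hL : 2 ≤ L) :
    (L + 4) * √(1 + V) ≤ 3 * L + ρ / (160 * a) + 360 * L ^ 2 * a * X := by
  have h0 : √(1 + V) ≤ 1 + √(ρ * X) := by
    refine Real.sqrt_le_iff.2 ⟨by positivity, ?_⟩
    have h1 := Real.sq_sqrt (show 0 ≤ ρ * X by positivity)
    nlinarith [Real.sqrt_nonneg (ρ * X)]
  have h1 : 3 * L * √(ρ * X) ≤ ρ / (160 * a) + 360 * L ^ 2 * a * X := by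
    refine abs_le_of_sq_le_sq' ?_ (by positivity) |>.2
    have h2 : (3 * L * √(ρ * X)) ^ 2 = 4 * (ρ / (160 * a)) * (360 * L ^ 2 * a * X) := by
      rw [mul_pow, Real.sq_sqrt (by positivity)]
      field_simp
      ring
    rw [h2]
    nlinarith [sq_nonneg (ρ / (160 * a) - 360 * L ^ 2 * a * X)]
  have h2 : (L + 4) * √(1 + V) ≤ 3 * L * (1 + √(ρ * X)) := by
    have := Real.sqrt_nonneg (1 + V)
    calc (L + 4) * √(1 + V) ≤ 3 * L * √(1 + V) := by gcongr; linarith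
      _ ≤ _ := by gcongr
  linarith

theorem CliqueInv.le (hS : Setting T G C) {c : ℝ} (hc : 8 ≤ c) {s : State G κ}
    (hs : Valid T C s) {j : Fin κ} {i : Fin K} (hi : i ∈ C j) {Y W X U U' W₁ W₂ : ℝ}
    (h : CliqueInv T C c j i s Y W X U U' W₁ W₂) :
    s.cumLoss - Y + 1 / s.p (.inl j) + 1
      ≤ 800 * Real.log (K * T) ^ 3 * epochScale G κ c s.eta + W := by
  have h1 := h.meta_inv.le hS hc hs
  simp only [rhoGain] at h1
  have hS1 := one_le_epochScale hS (c := c) (by linarith) hs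
  have hl1 := hS.one_le_log
  have hL2 := hS.two_le_log
  have hlL := hS.log_le_log
  have hη := hs.eta_pos
  have hsb := startBound_nonneg (c := c) (by linarith) hS hs
  have hrho := hs.two_le_rho j
  have hq := one_div_pos.2 (metaDomain_pos hS.T_pos hs.p_mem (.inl j))
  have hηS : s.eta * s.cumLoss ≤ epochScale G κ c s.eta := by
    have h2 := hs.cum_lt
    have h3 : 0 ≤ c * metaCard G κ := by positivity
    unfold epochScale; linarith
  have hηinv : 1 / s.eta ≤ epochScale G κ c s.eta := by
    have h2 : 1 / s.eta ≤ (κ + 1) / s.eta := by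
      gcongr; linarith [Nat.cast_nonneg (α := ℝ) κ]
    have h3 : 0 ≤ c * metaCard G κ := by positivity
    unfold epochScale; linarith
  set S := epochScale G κ c s.eta with hSdef
  set l := Real.log T with hldef
  set L := Real.log (K * T) with hLdef
  have hl0 : 0 < l := by linarith
  have hX := h.X_nonneg
  have h2 : X - U' ≤ 3 * L + (s.rho j + startBound T G κ c s.eta) / (160 * (s.eta * l))
      + 360 * L ^ 2 * (s.eta * l) * X := by
    refine le_trans ?_ (mul_sqrt_one_add_le (by positivity) (by linarith) hX h.sqSum_le hL2)
    have h3 := h.hedge_inv.le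
    have h4 : 0 ≤ √(1 + (s.hedge j).sqSum)
        * entropyDiv (hedgeComparator T (C j) i) (s.hedge j).prob :=
      mul_nonneg (Real.sqrt_nonneg _)
        (entropyDiv_nonneg hS.T_pos (hedgeComparator_mem hS.T_pos hi) (hs.hedge_mem j))
    linarith
  have h3 : (s.rho j + startBound T G κ c s.eta) / (160 * (s.eta * l))
      ≤ s.rho j / (80 * s.eta * l) / 2 + S := by
    have e : (s.rho j + startBound T G κ c s.eta) / (160 * (s.eta * l))
        = s.rho j / (80 * s.eta * l) / 2 + (S + 1 / s.eta * (1 / l)) / 40 := by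
      unfold startBound
      rw [← hSdef, ← hldef]
      field_simp
      ring
    have h4 : 1 / l ≤ 1 := by rw [div_le_one hl0]; exact hl1
    have h5 : 1 / s.eta * (1 / l) ≤ 1 / s.eta := mul_le_of_le_one_right (by positivity) h4
    rw [e]; linarith
  set N := s.rho j / (80 * s.eta * l) with hN
  have hN0 : 0 ≤ N := by
    have : 0 ≤ s.rho j := by linarith
    positivity
  -- This is where the summand `2000 log T log² (K T)` in the initial learning rate is needed.
  have ha : 360 * L ^ 2 * (s.eta * l) ≤ 1 / 4 := by
    have := hs.eta_le
    linarith
  have ha0 : 0 ≤ 360 * L ^ 2 * (s.eta * l) := by positivity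
  have hL3 : 4 ≤ L ^ 2 := by nlinarith
  have hfin : 2 * S * l + 48 * S + 3 * L + 1 + 720 * L ^ 2 * l * S ≤ 800 * L ^ 3 * S := by
    have e1 : 2 * S * l ≤ 2 * S * L := by gcongr
    have e2 : 720 * L ^ 2 * l * S ≤ 720 * L ^ 2 * L * S := by gcongr
    have e3 : 3 * L ≤ 3 * L * S := le_mul_of_one_le_right (by linarith) hS1
    have e4 : 0 ≤ L * S * (L ^ 2 - 4) := by
      have : 0 ≤ L ^ 2 - 4 := by linarith
      positivity
    have e5 : 0 ≤ S * (L - 2) := mul_nonneg (by linarith) (by linarith)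
    nlinarith
  have hU := h.U_le
  have hU' := h.U'_le
  have hW := h.W_eq
  have hW1 := h.W₁_nonneg
  -- If `X` is at most twice the learner's loss, the restart test controls `η X`. Otherwise half of
  -- `h1` is added to the Hedge bound: it still supplies `1 / p` and `N / 2`, and the remainder
  -- `cumLoss / 2 - X / 4` is nonpositive.
  rcases le_total X (2 * s.cumLoss) with hc2 | hc2
  · have h4 : 360 * L ^ 2 * (s.eta * l) * X ≤ 720 * L ^ 2 * l * S := by
      calc 360 * L ^ 2 * (s.eta * l) * X ≤ 360 * L ^ 2 * (s.eta * l) * (2 * s.cumLoss) := by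
            gcongr
        _ = 720 * L ^ 2 * l * (s.eta * s.cumLoss) := by ring
        _ ≤ _ := by gcongr
    linarith
  · have h4 : 360 * L ^ 2 * (s.eta * l) * X ≤ 1 / 4 * X := by gcongr
    have h5 : 0 ≤ 720 * L ^ 2 * l * S := by positivity
    have h6 : 0 ≤ S * l := by positivity
    linarith

theorem epochBound_clique (hS : Setting T G C) {c : ℝ} (hc : 8 ≤ c) {j : Fin κ} {i : Fin K}
    (hi : i ∈ C j) :
    EpochBound (G := G) T C c (800 * Real.log (K * T) ^ 3) i (hedgeInit (C j)).prob
      fun s Y W => ∃ X U U' W₁ W₂, CliqueInv T C c j i s Y W X U U' W₁ W₂ := by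
  refine ⟨fun η hη => ⟨0, 0, 0, 0, 0, cliqueInv_restart hS (by linarith) hη hi⟩, ?_, ?_, ?_⟩
  · rintro s Y W loss x hs hl ⟨X, U, U', W₁, W₂, h⟩
    exact h.advance hS (by linarith) hs hl x hi
  · rintro s Y W hs ⟨X, U, U', W₁, W₂, h⟩
    have h1 := h.le hS hc hs hi
    have h2 := one_div_pos.2 (metaDomain_pos hS.T_pos hs.p_mem (.inl j))
    linarith
  · rintro s Y W loss x hs hl ⟨X, U, U', W₁, W₂, h⟩
    have h1 := h.le hS hc hs hi
    have h3 := dotProduct_metaEst_le hS.partition hs.p_mem hl x hs.hedge_mem hS.T_pos (.inl j)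
    simp only at h3
    have h4 : 0 ≤ armEst C i loss s x := armEstimator_nonneg hS.partition hs.p_mem hl x i
    linarith

end

section

variable {K κ T : ℕ} {G : Digraph (Fin K)} {C : Fin κ → Finset (Fin K)}

theorem slack_nonneg (hS : Setting T G C) {s : State G κ} (hs : Valid T C s)
    {mix loss : Fin K → ℝ} (hmix : ∀ i, 0 ≤ mix i) (hl : ∀ i, loss i ∈ Set.Icc (0 : ℝ) 1)
    (x : Choice G κ) : 0 ≤ slack T C mix loss s x := by
  have h1 : 0 ≤ ∑ m, metaEst C loss s x m :=
    sum_nonneg fun m _ => (hs.lossBound hS hl x).nonneg m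
  have h2 : 0 ≤ mix ⬝ᵥ armEstimator C s x (feedback G loss x.2) := sum_nonneg fun i _ =>
    mul_nonneg (hmix i) (armEstimator_nonneg hS.partition hs.p_mem hl x i)
  unfold slack
  positivity

/-- A crude bound that only enters the logarithmic count of the epochs. -/
theorem Valid.dotProduct_metaEst_le_two_mul (hS : Setting T G C) {s : State G κ}
    (hs : Valid T C s) {loss : Fin K → ℝ} (hl : ∀ i, loss i ∈ Set.Icc (0 : ℝ) 1)
    (x : Choice G κ) : s.p ⬝ᵥ metaEst C loss s x ≤ 2 * T := by
  have hb := hs.lossBound hS hl x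
  have hT := hS.four_le_cast
  have hg : ∀ m, metaEst C loss s x m ≤ T := by
    rintro (j | v)
    · have h1 := hb.clique j
      have h2 := hs.p_mem.2 (.inl j)
      have h3 := mul_le_mul_of_nonneg_right h2 (hb.nonneg (.inl j))
      rw [one_div, inv_mul_eq_div] at h3
      have h4 := (div_le_iff₀ (by linarith)).1 (h3.trans h1)
      linarith
    · obtain ⟨m, hm⟩ := hS.exists_ne_noLoop v
      have h1 := hb.noLoop v
      have h2 : 1 / (T : ℝ) ≤ 1 - s.p (.inr v) := by
        linarith [metaDomain_add_le hs.p_mem hm, hs.p_mem.2 m]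
      have h3 := mul_le_mul_of_nonneg_right h2 (hb.nonneg (.inr v))
      rw [one_div, inv_mul_eq_div] at h3
      have h4 := (div_le_iff₀ (by linarith)).1 (h3.trans h1)
      linarith
  calc s.p ⬝ᵥ metaEst C loss s x ≤ ∑ m, s.p m * T :=
        sum_le_sum fun m _ => mul_le_mul_of_nonneg_left (hg m) (hs.p_mem.1.1 m)
    _ = T := by rw [← sum_mul, hs.p_mem.1.2, one_mul]
    _ ≤ 2 * T := by linarith

/-! ### All epochs together -/

/-- The progress of the algorithm over all epochs: `Z` is its estimated loss, `Y` that of the arm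
it is compared to, and `W` the slack. The parts from the epochs before the current one are `Zd`,
`Yd` and `Wd`. -/
structure RunInv (c Q η₁ : ℝ) (P : State G κ → ℝ → ℝ → Prop) (s : State G κ)
    (Z Y W Zd Yd Wd : ℝ) : Prop where
  current : P s (Y - Yd) (W - Wd)
  Z_eq : Z = Zd + s.cumLoss
  le : Zd - Yd ≤ Q * ((κ + 1) * (1 / s.eta - 1 / η₁)
    + c * metaCard G κ * (Real.log (η₁ / s.eta) / Real.log 2)) + Wd
  Zd_nonneg : 0 ≤ Zd
  eta_or : s.eta = η₁ ∨ (κ + 1) / s.eta ^ 2 ≤ 4 * Zd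

variable {c Q η₁ : ℝ} {i : Fin K} {mix : Fin K → ℝ} {P : State G κ → ℝ → ℝ → Prop}

theorem runInv_restart (hP : EpochBound T C c Q i mix P) (hη : 0 < η₁) :
    RunInv c Q η₁ P (restart T G C c η₁) 0 0 0 0 0 0 := by
  refine ⟨by simpa using hP.start η₁ hη, by simp [restart], ?_, le_rfl, .inl rfl⟩
  simp [restart, hη.ne']

/-- On a restart the finished epoch adds `Q * epochScale`. Halving `η` raises `1 / η` by exactly the
old `1 / η` and the binary logarithm by 1, so the bound is closed under epochs. The restart test
itself certifies `eta_or` for the new `η`. -/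
theorem RunInv.step (hS : Setting T G C) (hP : EpochBound T C c Q i mix P) (hη₁ : 0 < η₁)
    (hmix : ∀ i, 0 ≤ mix i) {s : State G κ} (hs : Valid T C s) {loss : Fin K → ℝ}
    (hl : ∀ i, loss i ∈ Set.Icc (0 : ℝ) 1) (x : Choice G κ) {Z Y W Zd Yd Wd : ℝ}
    (h : RunInv c Q η₁ P s Z Y W Zd Yd Wd) :
    ∃ Zd Yd Wd, RunInv c Q η₁ P (step T G C c loss s x) (Z + s.p ⬝ᵥ metaEst C loss s x)
      (Y + armEst C i loss s x) (W + slack T C mix loss s x) Zd Yd Wd := by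
  classical
  have hη := hs.eta_pos
  have hz : 0 ≤ s.p ⬝ᵥ metaEst C loss s x := sum_nonneg fun m _ =>
    mul_nonneg (hs.p_mem.1.1 m) ((hs.lossBound hS hl x).nonneg m)
  have hcum := hs.cum_nonneg
  have hZd := h.Zd_nonneg
  rw [step_eq]
  split_ifs with hr
  · refine ⟨Z + s.p ⬝ᵥ metaEst C loss s x, Y + armEst C i loss s x,
      W + slack T C mix loss s x, ?_, ?_, ?_, ?_, .inr ?_⟩
    · rw [sub_self, sub_self]; exact hP.start _ (half_pos hη)
    · simp [restart]
    · have h1 := hP.le_add s _ _ loss x hs hl h.current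
      have h2 := slack_nonneg hS hs hmix hl x
      have h3 := h.le
      have h4 : Real.log (η₁ / (s.eta / 2)) = Real.log (η₁ / s.eta) + Real.log 2 := by
        rw [← Real.log_mul (by positivity) two_ne_zero]
        congr 1
        field_simp
      have h5 : 1 / (s.eta / 2) = 1 / s.eta + 1 / s.eta := by field_simp; norm_num
      change _ ≤ Q * ((κ + 1) * (1 / (s.eta / 2) - 1 / η₁)
        + c * metaCard G κ * (Real.log (η₁ / (s.eta / 2)) / Real.log 2)) + _
      rw [h4, h5, add_div, div_self (Real.log_pos one_lt_two).ne']
      have h6 : epochScale G κ c s.eta = (κ + 1) * (1 / s.eta) + c * metaCard G κ := by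
        unfold epochScale; ring
      rw [h6] at h1
      have h7 := h.Z_eq
      linarith
    · rw [h.Z_eq]; linarith
    · change (κ + 1) / (s.eta / 2) ^ 2 ≤ _
      have h1 : (κ + 1) / (s.eta / 2) ^ 2 = 4 * ((κ + 1) / s.eta / s.eta) := by
        field_simp; norm_num
      rw [h1, h.Z_eq]
      have h2 : (κ + 1) / s.eta / s.eta ≤ s.cumLoss + s.p ⬝ᵥ metaEst C loss s x := by
        rw [div_le_iff₀ hη]; linarith
      linarith
  · refine ⟨Zd, Yd, Wd, ?_, ?_, h.le, hZd, h.eta_or⟩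
    · have := hP.advance s _ _ loss x hs hl h.current
      rwa [← add_sub_right_comm, ← add_sub_right_comm] at this
    · rw [h.Z_eq, add_assoc]; rfl

/-- Unless no restart has happened, `(κ + 1) / η² ≤ 4 Z`, and multiplying by `κ + 1` bounds `(κ + 1)
/ η` by `2 √((κ + 1) Z)`. The same inequality keeps `η` above `1 / T²`, so there are only
logarithmically many epochs. -/
theorem RunInv.regret_le (hS : Setting T G C) (hP : EpochBound T C c Q i mix P) (hQ : 0 ≤ Q)
    (hc : 0 ≤ c) (hη₁ : 0 < η₁) (hη₁1 : η₁ ≤ 1) {s : State G κ} (hs : Valid T C s)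
    {Z Y W Zd Yd Wd : ℝ} (h : RunInv c Q η₁ P s Z Y W Zd Yd Wd) (hZ : Z ≤ 2 * T * T) :
    Z - Y ≤ Q * ((κ + 1) / η₁ + 4 * √((κ + 1) * Z)
      + 4 * (c * metaCard G κ * Real.log (K * T))) + W := by
  have hη := hs.eta_pos
  have hcum := hs.cum_nonneg
  have hZd := h.Zd_nonneg
  have hl1 := hS.one_le_log
  have hL := hS.log_le_log
  have hT := hS.four_le_cast
  have hκ : (0 : ℝ) ≤ κ := Nat.cast_nonneg κ
  have hln2 := Real.log_two_gt_d9
  have h1 := hP.le s _ _ hs h.current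
  have h2 := h.le
  have h3 : (κ + 1) / s.eta ≤ (κ + 1) / η₁ + 2 * √((κ + 1) * Z) := by
    rcases h.eta_or with h4 | h4
    · rw [h4]; linarith [Real.sqrt_nonneg ((κ + 1) * Z)]
    · have h5 : (κ + 1) / s.eta ≤ √((κ + 1) * (4 * Z)) := by
        refine Real.le_sqrt_of_sq_le ?_
        have h6 : ((κ + 1) / s.eta) ^ 2 = (κ + 1) * ((κ + 1) / s.eta ^ 2) := by
          field_simp
        rw [h6]
        have : (κ + 1) / s.eta ^ 2 ≤ 4 * Z := by rw [h.Z_eq]; linarith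
        gcongr
      have h6 : √((κ + 1) * (4 * Z)) = 2 * √((κ + 1) * Z) := by
        rw [show (κ + 1) * (4 * Z) = 2 ^ 2 * ((κ + 1) * Z) by ring,
          Real.sqrt_mul (by norm_num), Real.sqrt_sq (by norm_num)]
      have h7 : 0 ≤ (κ + 1) / η₁ := by positivity
      linarith
  have h4 : 1 + Real.log (η₁ / s.eta) / Real.log 2 ≤ 4 * Real.log (K * T) := by
    suffices h5 : Real.log (η₁ / s.eta) ≤ 2 * Real.log T by
      have : Real.log (η₁ / s.eta) / Real.log 2 ≤ 3 * Real.log T := by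
        rw [div_le_iff₀ (by linarith)]; nlinarith
      linarith
    rcases h.eta_or with h5 | h5
    · rw [h5, div_self hη₁.ne', Real.log_one]; linarith
    · have h6 : Real.log (η₁ / s.eta) ≤ Real.log (T ^ 2) := by
        refine Real.log_le_log (by positivity) ?_
        rw [div_le_iff₀ hη]
        have h7 : 1 / s.eta ^ 2 ≤ (κ + 1) / s.eta ^ 2 := by gcongr; linarith
        have h8 : 1 / s.eta ^ 2 ≤ (T ^ 2 : ℝ) ^ 2 := by
          have h9 : Z = Zd + s.cumLoss := h.Z_eq
          have h10 : 8 * (T : ℝ) ^ 2 ≤ (T : ℝ) ^ 2 * T ^ 2 := by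
            have : (4 : ℝ) ^ 2 ≤ T ^ 2 := by gcongr
            nlinarith [sq_nonneg (T : ℝ)]
          nlinarith
        rw [div_le_iff₀ (by positivity), ← mul_pow] at h8
        have h11 : 1 ≤ (T : ℝ) ^ 2 * s.eta :=
          le_of_sq_le_sq (by simpa using h8) (by positivity)
        linarith
      rwa [Real.log_pow] at h6
  have h5 : 0 ≤ c * metaCard G κ := by positivity
  have h6 := mul_le_mul_of_nonneg_left h4 h5
  have h7 : Z - Y ≤ Q * (2 * ((κ + 1) / s.eta) - (κ + 1) / η₁
      + c * metaCard G κ * (1 + Real.log (η₁ / s.eta) / Real.log 2)) + W := by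
    have e1 : Q * (2 * ((κ + 1) / s.eta) - (κ + 1) / η₁
        + c * metaCard G κ * (1 + Real.log (η₁ / s.eta) / Real.log 2))
        = Q * ((κ + 1) * (1 / s.eta - 1 / η₁)
        + c * metaCard G κ * (Real.log (η₁ / s.eta) / Real.log 2))
        + Q * epochScale G κ c s.eta := by unfold epochScale; ring
    rw [e1, h.Z_eq]
    linarith
  refine h7.trans (add_le_add_left (mul_le_mul_of_nonneg_left ?_ hQ) _)
  have : 0 ≤ (κ + 1) / η₁ := by positivity
  linarith

end

section

variable {K κ T : ℕ} {G : Digraph (Fin K)} {C : Fin κ → Finset (Fin K)}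

/-! ### Conditional expectations in a round -/

/-- The expectation of `F` over the choices of a round that begins in state `s`. -/
noncomputable def roundMean (s : State G κ) (F : Choice G κ → ℝ) : ℝ :=
  ∑ x, choiceProb s x * F x

theorem roundMean_eq (s : State G κ) (F : Choice G κ → ℝ) :
    roundMean s F = ∑ j : Fin κ, s.p (.inl j) * ∑ a, (s.hedge j).prob a * F (.inl j, a)
      + ∑ v : NoLoop G, s.p (.inr v) * F (.inr v, v.1) := by
  unfold roundMean
  rw [Fintype.sum_prod_type, Fintype.sum_sum_type]
  congr 1
  · refine sum_congr rfl fun j _ => ?_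
    rw [mul_sum]
    exact sum_congr rfl fun a _ => by rw [choiceProb, mul_assoc]
  · refine sum_congr rfl fun v _ => ?_
    simp [choiceProb, ite_mul]

theorem roundMean_add (s : State G κ) (F F' : Choice G κ → ℝ) :
    roundMean s (fun x => F x + F' x) = roundMean s F + roundMean s F' := by
  simp [roundMean, mul_add, sum_add_distrib]

theorem roundMean_mul_left (s : State G κ) (a : ℝ) (F : Choice G κ → ℝ) :
    roundMean s (fun x => a * F x) = a * roundMean s F := by
  simp only [roundMean, mul_sum]
  exact sum_congr rfl fun _ _ => by ring

theorem roundMean_sum {ι : Type*} (s : State G κ) (t : Finset ι) (F : ι → Choice G κ → ℝ) :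
    roundMean s (fun x => ∑ k ∈ t, F k x) = ∑ k ∈ t, roundMean s (F k) := by
  simp only [roundMean, mul_sum]
  exact sum_comm

theorem Valid.choiceProb_nonneg {s : State G κ} (hs : Valid T C s) (x : Choice G κ) :
    0 ≤ choiceProb s x := by
  obtain ⟨j | v, a⟩ := x
  · exact mul_nonneg (hs.p_mem.1.1 _) ((hs.hedge_mem j).1.1 a)
  · unfold choiceProb
    simp only
    split_ifs
    · exact hs.p_mem.1.1 _
    · exact le_rfl

theorem Valid.roundMean_const {s : State G κ} (hs : Valid T C s) (a : ℝ) :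
    roundMean s (fun _ => a) = a := by
  rw [roundMean_eq]
  have h1 := hs.p_mem.1.2
  rw [Fintype.sum_sum_type] at h1
  simp only [← sum_mul, (hs.hedge_mem _).1.2, one_mul]
  rw [← add_mul, h1, one_mul]

/-- Unbiasedness, and the place where the graph structure is used. Every arm of a clique observes
the whole clique, so drawing the clique reveals all its losses; an arm without a self-loop is
observed exactly when another arm is pulled. -/
theorem Valid.roundMean_armEst (hS : Setting T G C) {s : State G κ} (hs : Valid T C s)
    (loss : Fin K → ℝ) (i : Fin K) : roundMean s (armEst C i loss s) = loss i := by
  classical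
  have hp := metaDomain_pos hS.T_pos hs.p_mem
  rw [roundMean_eq]
  by_cases hi : i ∈ inNbrs G i
  · obtain ⟨j, hj⟩ := (hS.partition.covers i).2 hi
    have h1 : ∀ j' a, armEst C i loss s (.inl j', a)
        = if j' = j then feedback G loss a i / s.p (.inl j) else 0 := fun j' a => by
      unfold armEst
      rw [armEstimator_clique hS.partition _ _ hj]
      simp
    have h2 : ∀ v : NoLoop G, armEst C i loss s (.inr v, v.1) = 0 := fun v => by
      unfold armEst
      rw [armEstimator_clique hS.partition _ _ hj]
      simp
    have h3 : ∑ a, (s.hedge j).prob a * (feedback G loss a i / s.p (.inl j))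
        = loss i / s.p (.inl j) := by
      have h4 : ∀ a, (s.hedge j).prob a * (feedback G loss a i / s.p (.inl j))
          = (s.hedge j).prob a * (loss i / s.p (.inl j)) := fun a => by
        by_cases ha : a ∈ C j
        · have : a ∈ inNbrs G i := by
            by_cases hai : a = i
            · rw [hai]; exact hi
            · exact hS.partition.clique j a ha i hj hai
          rw [feedback, if_pos this]
        · rw [(hs.hedge_mem j).2.2 a ha]; simp
      rw [sum_congr rfl fun a _ => h4 a, ← sum_mul, (hs.hedge_mem j).1.2, one_mul]
    simp only [h1, h2, mul_zero, sum_const_zero, add_zero, mul_ite]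
    rw [sum_eq_single j]
    · simp only [if_true]
      rw [h3, mul_div_cancel₀ _ (hp _).ne']
    · intro j' _ hj'
      simp [hj']
    · simp
  · set v : NoLoop G := ⟨i, hi⟩ with hv
    have hobs : inNbrs G i = {i}ᶜ := (hS.observable i).2.resolve_left hi
    have h0 : 0 < 1 - s.p (.inr v) := by
      obtain ⟨m, hm⟩ := hS.exists_ne_noLoop v
      linarith [metaDomain_add_le hs.p_mem hm, hp m]
    have hest : ∀ x : Choice G κ, armEst C i loss s x
        = if i ≠ x.2 then loss i / (1 - s.p (.inr v)) else 0 := fun x => by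
      have h1 := armEstimator_noLoop (C := C) (s := s) x (feedback G loss x.2) v
      change armEstimator C s x (feedback G loss x.2) i = _ at h1
      unfold armEst
      rw [h1]
      change (if i ≠ x.2 then _ else _) = _
      split_ifs with h
      · have : x.2 ∈ inNbrs G i := by rw [hobs]; exact fun h' => h h'.symm
        rw [feedback, if_pos this]
      · rfl
    have h1 : ∀ j, ∑ a, (s.hedge j).prob a * armEst C i loss s (.inl j, a)
        = loss i / (1 - s.p (.inr v)) := fun j => by
      have h2 : ∀ a, (s.hedge j).prob a * armEst C i loss s (.inl j, a)
          = (s.hedge j).prob a * (loss i / (1 - s.p (.inr v))) := fun a => by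
        by_cases ha : a ∈ C j
        · have : i ≠ a := fun h => hi (h ▸ hS.partition.mem_inNbrs ha)
          rw [hest, if_pos this]
        · rw [(hs.hedge_mem j).2.2 a ha]; simp
      rw [sum_congr rfl fun a _ => h2 a, ← sum_mul, (hs.hedge_mem j).1.2, one_mul]
    have h2 : ∀ v' : NoLoop G, s.p (.inr v') * armEst C i loss s (.inr v', v'.1)
        = s.p (.inr v') * (loss i / (1 - s.p (.inr v)))
          - if v' = v then s.p (.inr v) * (loss i / (1 - s.p (.inr v))) else 0 := fun v' => by
      rw [hest]
      by_cases h : v' = v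
      · subst h; simp [hv]
      · have : i ≠ v'.1 := fun h' => h (Subtype.ext h'.symm)
        simp [h, this]
    simp only [h1, h2, sum_sub_distrib, sum_ite_eq', mem_univ, if_true, ← sum_mul]
    have h3 := hs.p_mem.1.2
    rw [Fintype.sum_sum_type] at h3
    rw [← add_sub_assoc, ← add_mul, h3, ← sub_mul, mul_div_cancel₀ _ h0.ne']

/-- The loss of a meta-node in a state. -/
noncomputable def metaLoss (loss : Fin K → ℝ) (s : State G κ) : Meta G κ → ℝ
  | .inl j => (s.hedge j).prob ⬝ᵥ loss
  | .inr v => loss v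

theorem Valid.roundMean_metaEst (hS : Setting T G C) {s : State G κ} (hs : Valid T C s)
    (loss : Fin K → ℝ) (m : Meta G κ) :
    roundMean s (fun x => metaEst C loss s x m) = metaLoss loss s m := by
  rcases m with j | v
  · change roundMean s (fun x => ∑ i, (s.hedge j).prob i * armEst C i loss s x) = _
    rw [roundMean_sum]
    exact sum_congr rfl fun i _ => by rw [roundMean_mul_left, hs.roundMean_armEst hS]
  · exact hs.roundMean_armEst hS loss v.1

theorem Valid.roundMean_dotProduct (hS : Setting T G C) {s : State G κ} (hs : Valid T C s)
    (loss : Fin K → ℝ) : roundMean s (fun x => s.p ⬝ᵥ metaEst C loss s x)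
      = roundMean s (fun x => loss x.2) := by
  simp only [dotProduct]
  rw [roundMean_sum, roundMean_eq, Fintype.sum_sum_type]
  simp only [roundMean_mul_left, hs.roundMean_metaEst hS]
  rfl

theorem Valid.roundMean_slack_le (hS : Setting T G C) {s : State G κ} (hs : Valid T C s)
    {mix loss : Fin K → ℝ} (hmix : ∀ i, 0 ≤ mix i) (hmix1 : ∑ i, mix i ≤ 1)
    (hl : ∀ i, loss i ∈ Set.Icc (0 : ℝ) 1) :
    roundMean s (slack T C mix loss s) ≤ 1 / T * (metaCard G κ + 1) := by
  unfold slack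
  rw [roundMean_mul_left, roundMean_add, roundMean_sum]
  have h1 : roundMean s (fun x => mix ⬝ᵥ armEstimator C s x (feedback G loss x.2)) ≤ 1 := by
    change roundMean s (fun x => ∑ i, mix i * armEst C i loss s x) ≤ 1
    rw [roundMean_sum]
    refine le_trans (sum_le_sum fun i _ => ?_) hmix1
    rw [roundMean_mul_left, hs.roundMean_armEst hS]
    exact mul_le_of_le_one_right (hmix i) (hl i).2
  have h2 : ∑ m, roundMean s (fun x => metaEst C loss s x m) ≤ metaCard G κ := by
    have h3 : ∀ m : Meta G κ, roundMean s (fun x => metaEst C loss s x m) ≤ 1 := fun m => by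
      rw [hs.roundMean_metaEst hS]
      rcases m with j | v
      · change ∑ i, (s.hedge j).prob i * loss i ≤ 1
        rw [← (hs.hedge_mem j).1.2]
        exact sum_le_sum fun i _ => mul_le_of_le_one_right ((hs.hedge_mem j).1.1 i) (hl i).2
      · exact (hl v.1).2
    refine (sum_le_sum fun m _ => h3 m).trans ?_
    simp [metaCard]
  gcongr

/-! ### Expectations over a run -/

/-- The sum of `f t s x` over the first `n` rounds `t`, where `s` is the state at their beginning
and `x` lists the choices. -/
noncomputable def runSum (T : ℕ) (C : Fin κ → Finset (Fin K)) (c η : ℝ) (ℓ : ℕ → Fin K → ℝ)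
    (f : ℕ → State G κ → Choice G κ → ℝ) : (n : ℕ) → (Fin n → Choice G κ) → ℝ
  | 0, _ => 0
  | n + 1, ω => runSum T C c η ℓ f n (Fin.init ω)
      + f n (stateAfter T G C c η ℓ n (Fin.init ω)) (ω (Fin.last n))

/-- The expectation of `F` over the choices of the first `n` rounds. -/
noncomputable def runMean (T : ℕ) (C : Fin κ → Finset (Fin K)) (c η : ℝ) (ℓ : ℕ → Fin K → ℝ)
    (n : ℕ) (F : (Fin n → Choice G κ) → ℝ) : ℝ :=
  ∑ ω, runProb T G C c η ℓ n ω * F ω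

variable {c η : ℝ} {ℓ : ℕ → Fin K → ℝ}

theorem valid_stateAfter (hS : Setting T G C) (hc : 4 ≤ c) (hη : 0 < η)
    (hη1 : η * (2000 * Real.log T * Real.log (K * T) ^ 2) ≤ 1)
    (hℓ : ∀ t < T, ∀ i, ℓ t i ∈ Set.Icc (0 : ℝ) 1) :
    ∀ n ≤ T, ∀ ω, Valid T C (stateAfter T G C c η ℓ n ω)
  | 0, _, _ => valid_restart hS (by linarith) hη hη1
  | n + 1, hn, ω => (valid_stateAfter hS hc hη hη1 hℓ n (by omega) (Fin.init ω)).step hS hc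
      (hℓ n hn) _

theorem runProb_nonneg (hv : ∀ n ≤ T, ∀ ω, Valid T C (stateAfter T G C c η ℓ n ω)) :
    ∀ n ≤ T, ∀ ω, 0 ≤ runProb T G C c η ℓ n ω
  | 0, _, _ => zero_le_one
  | n + 1, hn, ω => mul_nonneg (runProb_nonneg hv n (by omega) (Fin.init ω))
      ((hv n (by omega) _).choiceProb_nonneg _)

theorem runMean_succ (n : ℕ) (F : (Fin (n + 1) → Choice G κ) → ℝ) :
    runMean T C c η ℓ (n + 1) F = runMean T C c η ℓ n fun ω =>
      roundMean (stateAfter T G C c η ℓ n ω) fun x =>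
        F (Fin.snoc (α := fun _ => Choice G κ) ω x) := by
  unfold runMean roundMean
  rw [← (Fin.snocEquiv fun _ : Fin (n + 1) => Choice G κ).sum_comp, Fintype.sum_prod_type,
    sum_comm]
  refine sum_congr rfl fun ω _ => ?_
  rw [mul_sum]
  refine sum_congr rfl fun x _ => ?_
  simp only [Fin.snocEquiv, Equiv.coe_fn_mk, runProb]
  rw [Fin.init_snoc (α := fun _ => Choice G κ), Fin.snoc_last (α := fun _ => Choice G κ)]
  ring

theorem runMean_mono (hv : ∀ n ≤ T, ∀ ω, Valid T C (stateAfter T G C c η ℓ n ω)) {n : ℕ}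
    (hn : n ≤ T) {F F' : (Fin n → Choice G κ) → ℝ} (h : ∀ ω, F ω ≤ F' ω) :
    runMean T C c η ℓ n F ≤ runMean T C c η ℓ n F' :=
  sum_le_sum fun ω _ => mul_le_mul_of_nonneg_left (h ω) (runProb_nonneg hv n hn ω)

theorem runMean_const (hv : ∀ n ≤ T, ∀ ω, Valid T C (stateAfter T G C c η ℓ n ω)) (a : ℝ) :
    ∀ n ≤ T, runMean (G := G) T C c η ℓ n (fun _ => a) = a
  | 0, _ => by simp [runMean, runProb]
  | n + 1, hn => by
      rw [runMean_succ]
      simp only [(hv n (by omega) _).roundMean_const]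
      exact runMean_const hv a n (by omega)

theorem runMean_add (n : ℕ) (F F' : (Fin n → Choice G κ) → ℝ) :
    runMean T C c η ℓ n (fun ω => F ω + F' ω)
      = runMean T C c η ℓ n F + runMean T C c η ℓ n F' := by
  simp [runMean, mul_add, sum_add_distrib]

theorem runMean_mul_left (n : ℕ) (a : ℝ) (F : (Fin n → Choice G κ) → ℝ) :
    runMean T C c η ℓ n (fun ω => a * F ω) = a * runMean T C c η ℓ n F := by
  simp only [runMean, mul_sum]
  exact sum_congr rfl fun _ _ => by ring

/-- Tower property: comparing conditional means in every valid state compares the means of the sums.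
-/
theorem runMean_runSum_le (hv : ∀ n ≤ T, ∀ ω, Valid T C (stateAfter T G C c η ℓ n ω))
    {f g : ℕ → State G κ → Choice G κ → ℝ}
    (h : ∀ t < T, ∀ s, Valid T C s → roundMean s (f t s) ≤ roundMean s (g t s)) :
    ∀ n ≤ T, runMean T C c η ℓ n (runSum T C c η ℓ f n)
      ≤ runMean T C c η ℓ n (runSum T C c η ℓ g n)
  | 0, _ => le_rfl
  | n + 1, hn => by
      have key : ∀ f : ℕ → State G κ → Choice G κ → ℝ,
          runMean T C c η ℓ (n + 1) (runSum T C c η ℓ f (n + 1))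
            = runMean T C c η ℓ n (runSum T C c η ℓ f n) + runMean T C c η ℓ n fun ω =>
              roundMean (stateAfter T G C c η ℓ n ω) (f n (stateAfter T G C c η ℓ n ω)) := by
        intro f
        rw [runMean_succ, ← runMean_add]
        congr 1
        funext ω
        simp only [runSum]
        rw [← (hv n (by omega) ω).roundMean_const (runSum T C c η ℓ f n ω), ← roundMean_add]
        congr 1
        funext x
        rw [Fin.init_snoc (α := fun _ => Choice G κ), Fin.snoc_last (α := fun _ => Choice G κ)]
      rw [key, key]
      exact add_le_add (runMean_runSum_le hv h n (by omega))
        (runMean_mono hv (by omega) fun ω => h n hn _ (hv n (by omega) ω))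

theorem runMean_sqrt_le (hv : ∀ n ≤ T, ∀ ω, Valid T C (stateAfter T G C c η ℓ n ω)) {n : ℕ}
    (hn : n ≤ T) {F : (Fin n → Choice G κ) → ℝ} (hF : ∀ ω, 0 ≤ F ω) :
    runMean T C c η ℓ n (fun ω => √(F ω)) ≤ √(runMean T C c η ℓ n F) := by
  have h1 := runMean_const hv 1 n hn
  simp only [runMean, mul_one] at h1
  have h2 := Real.strictConcaveOn_sqrt.concaveOn.le_map_sum (t := univ)
    (w := runProb T G C c η ℓ n) (p := F) (fun ω _ => runProb_nonneg hv n hn ω) h1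
    (fun ω _ => hF ω)
  simpa [runMean] using h2

theorem runSum_const (b : ℕ → ℝ) : ∀ (n : ℕ) (ω : Fin n → Choice G κ),
    runSum T C c η ℓ (fun t _ _ => b t) n ω = ∑ t ∈ range n, b t
  | 0, _ => by simp [runSum]
  | n + 1, ω => by rw [runSum, runSum_const b n, sum_range_succ]

theorem runSum_choice (f : ℕ → Choice G κ → ℝ) : ∀ (n : ℕ) (ω : Fin n → Choice G κ),
    runSum T C c η ℓ (fun t _ x => f t x) n ω = ∑ t : Fin n, f t (ω t)
  | 0, _ => by simp [runSum]
  | n + 1, ω => by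
      rw [runSum, runSum_choice f n, Fin.sum_univ_castSucc]; rfl

theorem runSum_le (hv : ∀ n ≤ T, ∀ ω, Valid T C (stateAfter T G C c η ℓ n ω))
    {f g : ℕ → State G κ → Choice G κ → ℝ}
    (h : ∀ t < T, ∀ s x, Valid T C s → f t s x ≤ g t s x) :
    ∀ n ≤ T, ∀ ω, runSum T C c η ℓ f n ω ≤ runSum T C c η ℓ g n ω
  | 0, _, _ => le_rfl
  | n + 1, hn, ω => add_le_add (runSum_le hv h n (by omega) _)
      (h n hn _ _ (hv n (by omega) _))

theorem runInv_stateAfter (hS : Setting T G C) (hη : 0 < η)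
    (hv : ∀ n ≤ T, ∀ ω, Valid T C (stateAfter T G C c η ℓ n ω))
    (hℓ : ∀ t < T, ∀ i, ℓ t i ∈ Set.Icc (0 : ℝ) 1) {Q : ℝ} {i : Fin K} {mix : Fin K → ℝ}
    (hmix : ∀ i, 0 ≤ mix i) {P : State G κ → ℝ → ℝ → Prop} (hP : EpochBound T C c Q i mix P) :
    ∀ n ≤ T, ∀ ω, ∃ Zd Yd Wd, RunInv c Q η P (stateAfter T G C c η ℓ n ω)
      (runSum T C c η ℓ (fun t s x => s.p ⬝ᵥ metaEst C (ℓ t) s x) n ω)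
      (runSum T C c η ℓ (fun t s x => armEst C i (ℓ t) s x) n ω)
      (runSum T C c η ℓ (fun t s x => slack T C mix (ℓ t) s x) n ω) Zd Yd Wd
  | 0, _, _ => ⟨0, 0, 0, runInv_restart hP hη⟩
  | n + 1, hn, ω => by
      obtain ⟨Zd, Yd, Wd, h⟩ :=
        runInv_stateAfter hS hη hv hℓ hmix hP n (by omega) (Fin.init ω)
      exact h.step hS hP hη hmix (hv n (by omega) _) (hℓ n hn) (ω (Fin.last n))

/-- Mean of the pathwise bound. The estimated loss of the learner has mean `regret + armLoss`,
Jensen moves the mean under the root, and the slack has mean at most `metaCard + 1` because of its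
factor `1 / T`. -/
theorem regret_le_of_epochBound (hS : Setting T G C) (hc : 4 ≤ c) (hη : 0 < η)
    (hη1 : η * (2000 * Real.log T * Real.log (K * T) ^ 2) ≤ 1)
    (hℓ : ∀ t < T, ∀ i, ℓ t i ∈ Set.Icc (0 : ℝ) 1) {Q : ℝ} (hQ : 0 ≤ Q) {i : Fin K}
    {mix : Fin K → ℝ} (hmix : ∀ i, 0 ≤ mix i) (hmix1 : ∑ i, mix i ≤ 1)
    {P : State G κ → ℝ → ℝ → Prop} (hP : EpochBound T C c Q i mix P) :
    regret T G C c η ℓ i ≤ Q * ((κ + 1) / η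
      + 4 * √((κ + 1) * (regret T G C c η ℓ i + armLoss T ℓ i))
      + 4 * (c * metaCard G κ * Real.log (K * T))) + (metaCard G κ + 1) := by
  have hv := valid_stateAfter hS hc hη hη1 hℓ
  have hT0 : (0 : ℝ) < T := by linarith [hS.four_le_cast]
  have hη_le : η ≤ 1 := by
    have h1 := (hv 0 (Nat.zero_le _) Fin.elim0).mul_eta_le_one hS
    change 8000 * η ≤ 1 at h1
    linarith
  set Z := runSum T C c η ℓ (fun t (s : State G κ) x => s.p ⬝ᵥ metaEst C (ℓ t) s x) T with hZ
  set Y := runSum T C c η ℓ (fun t (s : State G κ) x => armEst C i (ℓ t) s x) T with hY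
  set W := runSum T C c η ℓ (fun t (s : State G κ) x => slack T C mix (ℓ t) s x) T with hW
  have hZle : ∀ ω, Z ω ≤ 2 * T * T := fun ω => by
    refine (runSum_le hv (g := fun _ _ _ => 2 * (T : ℝ)) (fun t ht s x hs =>
      hs.dotProduct_metaEst_le_two_mul hS (hℓ t ht) x) T le_rfl ω).trans ?_
    rw [runSum_const]
    simp [mul_comm]
  have hZ0 : ∀ ω, 0 ≤ Z ω := fun ω => by
    refine le_trans ?_ (runSum_le hv (f := fun _ _ _ => 0) (fun t ht s x hs =>
      sum_nonneg fun m _ => mul_nonneg (hs.p_mem.1.1 m)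
        ((hs.lossBound hS (hℓ t ht) x).nonneg m)) T le_rfl ω)
    rw [runSum_const]
    simp
  have hpath : ∀ ω, Z ω ≤ Q * ((κ + 1) / η + 4 * (c * metaCard G κ * Real.log (K * T)))
      + (Y ω + (W ω + 4 * Q * √((κ + 1) * Z ω))) := fun ω => by
    obtain ⟨Zd, Yd, Wd, h⟩ := runInv_stateAfter hS hη hv hℓ hmix hP T le_rfl ω
    have := h.regret_le hS hP hQ (by linarith) hη hη_le (hv T le_rfl ω) (hZle ω)
    linarith
  have hmean := runMean_mono hv le_rfl hpath
  rw [runMean_add, runMean_add, runMean_add, runMean_const hv _ T le_rfl,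
    runMean_mul_left] at hmean
  have hloss : runMean T C c η ℓ T (fun ω : Fin T → Choice G κ => ∑ t : Fin T, ℓ t (ω t).2)
      = runMean T C c η ℓ T Z := by
    have h1 : (fun ω : Fin T → Choice G κ => ∑ t : Fin T, ℓ t (ω t).2)
        = runSum T C c η ℓ (fun t _ x => ℓ t x.2) T := by
      funext ω
      rw [runSum_choice fun t (x : Choice G κ) => ℓ t x.2]
    rw [h1]
    exact le_antisymm
      (runMean_runSum_le hv (fun t _ s hs => (hs.roundMean_dotProduct hS (ℓ t)).ge) T le_rfl)
      (runMean_runSum_le hv (fun t _ s hs => (hs.roundMean_dotProduct hS (ℓ t)).le) T le_rfl)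
  have hYle : runMean T C c η ℓ T Y ≤ armLoss T ℓ i := by
    refine (runMean_runSum_le hv (g := fun t _ _ => ℓ t i) (fun t _ s hs => ?_) T le_rfl).trans ?_
    · rw [hs.roundMean_const]
      exact (hs.roundMean_armEst hS (ℓ t) i).le
    · have : runSum (G := G) (κ := κ) T C c η ℓ (fun t _ _ => ℓ t i) T
          = fun _ => armLoss T ℓ i := by
        funext ω; rw [runSum_const fun t => ℓ t i]; rfl
      rw [this, runMean_const hv _ T le_rfl]
  have hWle : runMean T C c η ℓ T W ≤ metaCard G κ + 1 := by
    refine (runMean_runSum_le hv (g := fun _ _ _ => 1 / T * ((metaCard G κ : ℝ) + 1))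
      (fun t ht s hs => ?_) T le_rfl).trans ?_
    · rw [hs.roundMean_const]
      exact hs.roundMean_slack_le hS hmix hmix1 (hℓ t ht)
    · have : runSum (G := G) (κ := κ) T C c η ℓ
          (fun _ _ _ => 1 / T * ((metaCard G κ : ℝ) + 1)) T
          = fun _ => (metaCard G κ : ℝ) + 1 := by
        funext ω
        rw [runSum_const fun _ => 1 / T * ((metaCard G κ : ℝ) + 1)]
        simp only [sum_const, card_range, nsmul_eq_mul]
        field_simp
      rw [this, runMean_const hv _ T le_rfl]
  have hreg : regret T G C c η ℓ i = runMean T C c η ℓ T Z - armLoss T ℓ i := by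
    rw [← hloss]
    have h1 := runMean_add (T := T) (C := C) (c := c) (η := η) (ℓ := ℓ) T
      (fun ω : Fin T → Choice G κ => ∑ t : Fin T, ℓ t (ω t).2) (fun _ => -armLoss T ℓ i)
    rw [runMean_const hv _ T le_rfl] at h1
    rw [sub_eq_add_neg, ← h1]
    rfl
  have hsqrt := runMean_sqrt_le hv le_rfl (F := fun ω => ((κ : ℝ) + 1) * Z ω)
    (fun ω => mul_nonneg (by positivity) (hZ0 ω))
  rw [runMean_mul_left] at hsqrt
  have hmul := mul_le_mul_of_nonneg_left hsqrt (show 0 ≤ 4 * Q by linarith)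
  have hEZ : regret T G C c η ℓ i + armLoss T ℓ i = runMean T C c η ℓ T Z := by
    rw [hreg]; ring
  rw [hEZ, hreg]
  linarith

end

/-! ### The self-bounding inequality and the final constants. -/

/-- Split the root into `√a √R + √(a L)` and absorb `B √a √R ≤ (B² a + R) / 2` on the left. -/
theorem le_of_le_add_mul_sqrt {R A B a L : ℝ} (hB : 0 ≤ B) (ha : 0 ≤ a) (hL : 0 ≤ L)
    (hA : 0 ≤ A) (h : R ≤ A + B * √(a * (R + L))) :
    R ≤ 2 * A + 2 * B * √(a * L) + B ^ 2 * a := by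
  rcases le_total R 0 with hR | hR
  · have := Real.sqrt_nonneg (a * L)
    have : 0 ≤ 2 * A + 2 * B * √(a * L) + B ^ 2 * a := by positivity
    linarith
  · have h1 : √(a * (R + L)) ≤ √a * √R + √(a * L) := by
      rw [mul_add, ← Real.sqrt_mul ha]
      refine Real.sqrt_le_iff.2 ⟨by positivity, ?_⟩
      have h2 := Real.sq_sqrt (mul_nonneg ha hR)
      have h3 := Real.sq_sqrt (mul_nonneg ha hL)
      have h4 := mul_nonneg (Real.sqrt_nonneg (a * R)) (Real.sqrt_nonneg (a * L))
      linarith [add_sq (√(a * R)) (√(a * L))]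
    have h2 := mul_le_mul_of_nonneg_left h1 hB
    have h3 := Real.sq_sqrt ha
    have h4 := Real.sq_sqrt hR
    nlinarith [sq_nonneg (B * √a - √R)]

theorem exists_epochBound {K κ T : ℕ} {G : Digraph (Fin K)} {C : Fin κ → Finset (Fin K)}
    (hS : Setting T G C) {c : ℝ} (hc : 8 ≤ c) (i : Fin K) :
    ∃ (mix : Fin K → ℝ) (P : State G κ → ℝ → ℝ → Prop), (∀ i, 0 ≤ mix i) ∧ ∑ i, mix i ≤ 1 ∧
      EpochBound T C c (800 * Real.log (K * T) ^ 3) i mix P := by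
  by_cases hi : i ∈ inNbrs G i
  · obtain ⟨j, hj⟩ := (hS.partition.covers i).2 hi
    have h := hedgeInit_mem (T := T) hS.T_pos ⟨i, hj⟩
    exact ⟨_, _, h.1.1, h.1.2.le, epochBound_clique hS hc hj⟩
  · exact ⟨_, _, fun _ => le_rfl, by simp, epochBound_noLoop hS hc ⟨i, hi⟩⟩

end GraphBandit

theorem mainTheorem8 :
    ∃ (A : ℝ) (m : ℕ), ∀ (K T κ : ℕ), 2 ≤ K → 2 * K ≤ T →
      ∀ (G : Digraph (Fin K)), GraphBandit.StronglyObservable G →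
      ∀ (C : Fin κ → Finset (Fin K)), GraphBandit.IsCliquePartition G C →
      ∀ (ℓ : ℕ → Fin K → ℝ), (∀ t < T, ∀ i, ℓ t i ∈ Set.Icc (0 : ℝ) 1) →
      ∀ (iStar : Fin K),
        (∀ i, GraphBandit.armLoss T ℓ iStar ≤ GraphBandit.armLoss T ℓ i) →
        GraphBandit.regret T G C (64 * (GraphBandit.metaCard G κ : ℝ))
            (1 / (2000 * Real.log T * Real.log ((K : ℝ) * T) ^ 2 + 80 * κ * Real.log T))
            ℓ iStar ≤
          A * Real.log ((K : ℝ) * T) ^ m *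
            (√(((κ : ℝ) + 1) * GraphBandit.armLoss T ℓ iStar)
              + (GraphBandit.metaCard G κ : ℝ) ^ 2) := by
  -- The power 6 arises twice: from `B ^ 2` with `B = 3200 * L ^ 3`, and from the factor `L ^ 3`
  -- times the inverse initial rate `D`, itself of order `L ^ 3 * β`. The constant exceeds twice the
  -- sum of the coefficients in `e1`, `e2`, `e3` plus that of `e4`.
  refine ⟨30000000, 6, fun K T κ hK hT G hG C hC ℓ hℓ i _ => ?_⟩
  have hS : GraphBandit.Setting T G C := ⟨hK, hT, hG, hC⟩
  have hβ := hS.one_le_metaCard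
  have hκβ : (κ : ℝ) ≤ GraphBandit.metaCard G κ := by
    exact_mod_cast GraphBandit.kappa_le_metaCard
  have hκ : (0 : ℝ) ≤ κ := Nat.cast_nonneg κ
  have hl1 := hS.one_le_log
  have hL2 := hS.two_le_log
  have hlL := hS.log_le_log
  have hLs : 0 ≤ GraphBandit.armLoss T ℓ i :=
    Finset.sum_nonneg fun t ht => (hℓ t (Finset.mem_range.1 ht) i).1
  set β : ℝ := (GraphBandit.metaCard G κ : ℝ) with hβdef
  set l := Real.log T with hl
  set L := Real.log ((K : ℝ) * T) with hL
  set D := 2000 * l * L ^ 2 + 80 * κ * l with hD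
  have hl0 : 0 < l := by linarith
  have hL0 : 0 < L := by linarith
  have hD0 : 0 < D := by positivity
  have hη1 : 1 / D * (2000 * l * L ^ 2) ≤ 1 := by
    rw [one_div, inv_mul_le_iff₀ hD0]
    have : 0 ≤ 80 * κ * l := by positivity
    linarith
  obtain ⟨mix, P, hmix, hmix1, hP⟩ :=
    GraphBandit.exists_epochBound hS (c := 64 * β) (by linarith) i
  have h := GraphBandit.regret_le_of_epochBound hS (by linarith) (one_div_pos.2 hD0)
    hη1 hℓ (by positivity) hmix hmix1 hP
  set R := GraphBandit.regret T G C (64 * β) (1 / D) ℓ i with hR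
  set S := √(((κ : ℝ) + 1) * GraphBandit.armLoss T ℓ i) with hSdef
  have hS0 : 0 ≤ S := Real.sqrt_nonneg _
  rw [div_div_eq_mul_div, div_one] at h
  have hmain := GraphBandit.le_of_le_add_mul_sqrt
    (A := 800 * L ^ 3 * ((κ + 1) * D + 4 * (64 * β * β * L)) + (β + 1))
    (B := 3200 * L ^ 3) (a := (κ : ℝ) + 1) (by positivity) (by positivity) hLs (by positivity)
    (R := R) (by linarith)
  have hL1 : 1 ≤ L := by linarith
  have hβ2 : β ≤ β ^ 2 := by nlinarith
  have hκ2 : (κ : ℝ) + 1 ≤ 2 * β := by linarith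
  have hD_le : D ≤ 2080 * L ^ 3 * β := by
    have h1 : 2000 * l * L ^ 2 ≤ 2000 * L ^ 3 * β := by
      calc 2000 * l * L ^ 2 ≤ 2000 * L * L ^ 2 := by gcongr
        _ = 2000 * L ^ 3 * 1 := by ring
        _ ≤ 2000 * L ^ 3 * β := by gcongr
    have h2 : 80 * κ * l ≤ 80 * L ^ 3 * β := by
      have : L ≤ L ^ 3 := le_self_pow₀ hL1 (by norm_num)
      calc 80 * κ * l ≤ 80 * β * L ^ 3 := by gcongr; linarith
        _ = _ := by ring
    linarith
  have hL36 : L ^ 3 ≤ L ^ 6 := pow_le_pow_right₀ hL1 (by norm_num)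
  have hL6 : 1 ≤ L ^ 6 := one_le_pow₀ hL1
  have e1 : 800 * L ^ 3 * ((κ + 1) * D) ≤ 3328000 * (L ^ 6 * β ^ 2) := by
    calc 800 * L ^ 3 * ((κ + 1) * D) ≤ 800 * L ^ 3 * (2 * β * (2080 * L ^ 3 * β)) := by gcongr
      _ = _ := by ring
  have e2 : 800 * L ^ 3 * (4 * (64 * β * β * L)) ≤ 204800 * (L ^ 6 * β ^ 2) := by
    have h1 : L ^ 4 ≤ L ^ 6 := pow_le_pow_right₀ hL1 (by norm_num)
    calc 800 * L ^ 3 * (4 * (64 * β * β * L)) = 204800 * (L ^ 4 * β ^ 2) := by ring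
      _ ≤ _ := by gcongr
  have e3 : β + 1 ≤ 2 * (L ^ 6 * β ^ 2) := by
    have h1 : β ^ 2 ≤ L ^ 6 * β ^ 2 := le_mul_of_one_le_left (by positivity) hL6
    linarith
  have e4 : (3200 * L ^ 3) ^ 2 * ((κ : ℝ) + 1) ≤ 20480000 * (L ^ 6 * β ^ 2) := by
    calc (3200 * L ^ 3) ^ 2 * ((κ : ℝ) + 1) ≤ (3200 * L ^ 3) ^ 2 * (2 * β ^ 2) := by
          gcongr; linarith
      _ = _ := by ring
  have e5 : 2 * (3200 * L ^ 3) * S ≤ 6400 * (L ^ 6 * S) := by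
    calc 2 * (3200 * L ^ 3) * S = 6400 * (L ^ 3 * S) := by ring
      _ ≤ _ := by gcongr
  have e6 : 0 ≤ L ^ 6 * S := by positivity
  have e7 : 0 ≤ L ^ 6 * β ^ 2 := by positivity
  linarith
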